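/- **Setting.** Let $l_0,l_1,\dots\ge 1$ be integers, $n_0=1$, $n_{i+1}=l_in_i$. For each $i$ let $\xi_{i,1},\dots,\xi_{i,l_i}:[0,1]\to[0,1]$ be continuous paths (listed with multiplicity), let $u_{i,i+1}\in C([0,1],M_{n_{i+1}})$ be unitary, and put, for $f\in C([0,1],M_{n_i})$, $$\tilde\phi_i(f)=\operatorname{diag}(f\circ\xi_{i,1},\dots,f\circ\xi_{i,l_i}),\qquad \phi_i(f)=u_{i,i+1}\,\tilde\phi_i(f)\,u_{i,i+1}^*.$$ Let $\tilde\phi_{i,m}$, $\phi_{i,m}$ be the composites from stage $i$ to stage $m$. The paths of $\phi_{i,m}$ are the composites $\xi_{i,s_i}\circ\xi_{i+1,s_{i+1}}\circ\cdots\circ\xi_{m-1,s_{m-1}}$ (the identity if $m=i$). Assume every path $\eta$ of $\phi_{i,i+d}$ satisfies $|\eta(x)-\eta(y)|\le 2^{-d}$ for all $x,y\in[0,1]$. Let $B_i\subset C([0,1],M_{n_i})$ be unital $C^*$-subalgebras with $B_0=\mathbb C$ and $\phi_i(B_i)\subset B_{i+1}$ such that the Lipschitz functions (for the operator norm) in $B_i$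 are dense in $B_i$. Let $B=\varinjlim(B_i,\phi_i)$ be the $C^*$-inductive limit, with canonical maps $\phi_{i,\infty}:B_i\to B$. Define $u_0=1$ and $u_{i+1}=u_{i,i+1}\tilde\phi_i(u_i)$ (so $\phi_{0,i}=u_i\tilde\phi_{0,i}(\cdot)u_i^*$), and assume that each $u_i$ is a Lipschitz function. For $f\in B_i$ write $f=u_i\tilde f u_i^*$. Let $M=\varinjlim(M_{n_i},\psi_i)$, $\psi_i(a)=a\otimes 1=\operatorname{diag}(a,\dots,a)$, be the UHF algebra with canonical maps $\psi_{m,\infty}:M_{n_m}\to M$, let $\tau$ be its trace (the normalized trace on every $M_{n_i}$), let $\mathfrak H$ be the GNS space of $\tau$, and let $\mathfrak H_i\subset\mathfrak H$ be the image of $M_{n_i}$. Let $r:\mathbb N\to\mathbb N$ be strictly increasing with $r(0)=0$ such that, whenever $i\le r(j)$ and $d\ge0$, every path $\eta$ of $\phi_{i,r(j+d)}$ satisfies $|\eta(x)-\eta(y)|\le 2^{-2d}$ for all $x,y$ (the choice $r(i)=2i$ always has this property). Let $Q_0$ be the orthogonal projection of $\mathfrak H$ onto $\mathfrak H_{r(0)}=\mathfrak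 H_0$ and $Q_n$, $n\ge1$, the one onto $\mathfrak H_{r(n)}\ominus\mathfrak H_{r(n-1)}$. Let $1<\gamma<2$, and let $LB_i$ be the set of $f\in B_i$ with Lipschitz constant smaller than $\gamma^i$. Let $\bigcup_iLB_i\subset B$ be the union of the images $\phi_{i,\infty}(LB_i)$ and let $\mathcal A$ be the unital $*$-subalgebra of $B$ generated by $\bigcup_iLB_i$. Let $(\alpha_n)$ be real numbers with $\alpha_0=0$, $|\alpha_n|\to\infty$ and $|\alpha_n|\le\beta^{2(n-1)}$ for all $n\ge1$, for some $0<\beta<2$. Let $D=\sum_n\alpha_nQ_n$ with domain $\{v\in\mathfrak H:\sum_n\|\alpha_nQ_nv\|^2<\infty\}$. **Proposition.** There is an injective unital $*$-homomorphism $\iota:B\to M$ with $$\iota(\phi_{i,\infty}(f))=\lim_{m\to\infty}\psi_{m,\infty}\big(\tilde\phi_{i,m}(\tilde f)(0)\big)\qquad(f\in B_i),$$ and, with $B$ acting on $\mathfrak H$ through $\iota$ and the GNS representation of $M$, the following hold. 1. $(\mathcal A,\mathfrak H,D)$ is a spectral triple for $B$: $\mathcal A$ is dense in $B$, the representation of $B$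 is faithful, $D$ is self-adjoint with compact resolvent, and every $a\in\mathcal A$ maps the domain of $D$ into itself with $[D,a]$ extending to a bounded operator on $\mathfrak H$. 2. If there is a constant $C$ such that all the functions $u_i$ and all paths of all $\phi_{i,m}$ are Lipschitz with constant at most $C$, then $\bigcup_iLB_i$ is itself a $*$-subalgebra, that is, $\mathcal A=\bigcup_iLB_i$. 3. For every $p>0$ with $\sum_{i\ge1}(1+\alpha_i^2)^{-p/2}\big(n_{r(i)}^2-n_{r(i-1)}^2\big)<\infty$, the triple is $p$-summable, i.e. $\operatorname{Tr}\big((1+D^2)^{-p/2}\big)<\infty$. -/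

import Mathlib

open Filter Topology
open scoped unitInterval Matrix.Norms.L2Operator

noncomputable section

/-! ### Inductive limits of sequences of unital C⋆-algebras -/

section Limit

variable {X : ℕ → Type} [∀ i, CStarAlgebra (X i)] (φ : ∀ i, X i →⋆ₐ[ℂ] X (i + 1))

/-- The composite connecting morphism `X i → X j` for `i ≤ j`. -/
def seqMap (i j : ℕ) (h : i ≤ j) : X i →⋆ₐ[ℂ] X j :=
  Nat.leRecOn (C := fun k => X i →⋆ₐ[ℂ] X k) h (fun {k} g => (φ k).comp g) (StarAlgHom.id ℂ (X i))

theorem seqMap_self (i : ℕ) (h : i ≤ i) : seqMap φ i i h = StarAlgHom.id ℂ (X i) :=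
  Nat.leRecOn_self _

theorem seqMap_succ (i j : ℕ) (h : i ≤ j) :
    seqMap φ i (j + 1) (h.trans j.le_succ) = (φ j).comp (seqMap φ i j h) :=
  Nat.leRecOn_succ h _

theorem seqMap_seqMap (i j k : ℕ) (hij : i ≤ j) (hjk : j ≤ k) (x : X i) :
    seqMap φ j k hjk (seqMap φ i j hij x) = seqMap φ i k (hij.trans hjk) x := by
  induction k, hjk using Nat.le_induction with
  | base => rw [seqMap_self]; rfl
  | succ k hjk ih =>
    rw [seqMap_succ φ j k hjk, seqMap_succ φ i k (hij.trans hjk), StarAlgHom.comp_apply, ih,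
      StarAlgHom.comp_apply]

instance seqMap_directedSystem : DirectedSystem X (fun i j h => seqMap φ i j h) where
  map_self i x := by rw [seqMap_self]; rfl
  map_map i j k hij hjk x := seqMap_seqMap φ _ _ _ hij hjk x

/-- The algebraic direct limit of the sequence. -/
def AlgLimit : Type := DirectLimit X (seqMap φ)

instance : Ring (AlgLimit φ) := inferInstanceAs (Ring (DirectLimit X (seqMap φ)))
instance : Algebra ℂ (AlgLimit φ) := inferInstanceAs (Algebra ℂ (DirectLimit X (seqMap φ)))
instance : StarRing (AlgLimit φ) where
  toInvolutiveStar := inferInstanceAs (InvolutiveStar (DirectLimit X (seqMap φ)))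
  star_mul := StarMul.star_mul (R := DirectLimit X (seqMap φ))
  star_add := StarAddMonoid.star_add (R := DirectLimit X (seqMap φ))
instance : StarModule ℂ (AlgLimit φ) :=
  inferInstanceAs (StarModule ℂ (DirectLimit X (seqMap φ)))

/-- The canonical map of the `i`-th algebra into the algebraic direct limit. -/
def AlgLimit.of (i : ℕ) : X i →⋆ₐ[ℂ] AlgLimit φ where
  toFun x := (⟦⟨i, x⟩⟧ : DirectLimit X (seqMap φ))
  map_one' := (DirectLimit.one_def i).symm
  map_mul' x y := (DirectLimit.mul_def i x y).symm
  map_zero' := (DirectLimit.zero_def i).symm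
  map_add' x y := (DirectLimit.add_def i x y).symm
  commutes' c := (DirectLimit.map₀_def (seqMap φ) (fun i => algebraMap ℂ (X i) c)
    (fun i j h => AlgHomClass.commutes (seqMap φ i j h) c) i).symm
  map_star' _ := rfl

theorem AlgLimit.of_seqMap (i j : ℕ) (h : i ≤ j) (x : X i) :
    AlgLimit.of φ j (seqMap φ i j h x) = AlgLimit.of φ i x :=
  Quotient.sound ⟨j, le_rfl, h, by rw [seqMap_self]; rfl⟩

theorem AlgLimit.exists_of (z : AlgLimit φ) : ∃ i x, AlgLimit.of φ i x = z := by
  obtain ⟨i, x, h⟩ := DirectLimit.exists_eq_mk (seqMap φ) z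
  exact ⟨i, x, h.symm⟩

theorem AlgLimit.of_eq_iff (i j : ℕ) (x : X i) (y : X j) :
    AlgLimit.of φ i x = AlgLimit.of φ j y ↔
      ∃ k, ∃ hi : i ≤ k, ∃ hj : j ≤ k, seqMap φ i k hi x = seqMap φ j k hj y :=
  Quotient.eq

/-- The values `‖x‖` over all representatives `x` of an element of the direct limit. -/
def AlgLimit.normSet (z : AlgLimit φ) : Set ℝ := {r | ∃ i, ∃ x : X i, AlgLimit.of φ i x = z ∧ r = ‖x‖}

theorem AlgLimit.normSet_nonempty (z : AlgLimit φ) : (AlgLimit.normSet φ z).Nonempty := by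
  obtain ⟨i, x, h⟩ := AlgLimit.exists_of φ z
  exact ⟨_, i, x, h, rfl⟩

theorem AlgLimit.normSet_bddBelow (z : AlgLimit φ) : BddBelow (AlgLimit.normSet φ z) :=
  ⟨0, by rintro _ ⟨i, x, -, rfl⟩; exact norm_nonneg x⟩

theorem AlgLimit.sInf_le (i : ℕ) (x : X i) : sInf (AlgLimit.normSet φ (AlgLimit.of φ i x)) ≤ ‖x‖ :=
  csInf_le (AlgLimit.normSet_bddBelow φ _) ⟨i, x, rfl, rfl⟩

theorem AlgLimit.exists_lt (z : AlgLimit φ) {ε : ℝ} (hε : 0 < ε) :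
    ∃ i, ∃ x : X i, AlgLimit.of φ i x = z ∧ ‖x‖ < sInf (AlgLimit.normSet φ z) + ε := by
  obtain ⟨_, ⟨i, x, h, rfl⟩, hlt⟩ :=
    exists_lt_of_csInf_lt (AlgLimit.normSet_nonempty φ z) (lt_add_of_pos_right _ hε)
  exact ⟨i, x, h, hlt⟩

theorem seqMap_norm_le (i j : ℕ) (h : i ≤ j) (x : X i) : ‖seqMap φ i j h x‖ ≤ ‖x‖ :=
  NonUnitalStarAlgHom.norm_apply_le _ x

theorem AlgLimit.exists_lt₂ (z w : AlgLimit φ) {ε : ℝ} (hε : 0 < ε) :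
    ∃ i, ∃ x y : X i, AlgLimit.of φ i x = z ∧ AlgLimit.of φ i y = w ∧
      ‖x‖ < sInf (AlgLimit.normSet φ z) + ε ∧ ‖y‖ < sInf (AlgLimit.normSet φ w) + ε := by
  obtain ⟨i, x, hx, hx'⟩ := AlgLimit.exists_lt φ z hε
  obtain ⟨j, y, hy, hy'⟩ := AlgLimit.exists_lt φ w hε
  refine ⟨max i j, seqMap φ i _ (le_max_left i j) x, seqMap φ j _ (le_max_right i j) y, ?_, ?_,
    (seqMap_norm_le φ _ _ _ x).trans_lt hx', (seqMap_norm_le φ _ _ _ y).trans_lt hy'⟩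
  · rw [AlgLimit.of_seqMap, hx]
  · rw [AlgLimit.of_seqMap, hy]

theorem AlgLimit.sInf_nonneg (z : AlgLimit φ) : 0 ≤ sInf (AlgLimit.normSet φ z) :=
  le_csInf (AlgLimit.normSet_nonempty φ z) (by rintro _ ⟨i, x, -, rfl⟩; exact norm_nonneg x)

/-- The C⋆-seminorm of the direct limit: the infimum of the norms of the representatives, which
for the class of `x : X i` equals `lim_j ‖φ_{i,j}(x)‖`. -/
def AlgLimit.ringSeminorm : RingSeminorm (AlgLimit φ) where
  toFun z := sInf (AlgLimit.normSet φ z)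
  map_zero' := le_antisymm
    (by simpa using AlgLimit.sInf_le φ 0 (0 : X 0)) (AlgLimit.sInf_nonneg φ 0)
  add_le' z w := le_of_forall_pos_le_add fun ε hε => by
    obtain ⟨i, x, y, rfl, rfl, hx, hy⟩ := AlgLimit.exists_lt₂ φ z w (half_pos hε)
    rw [← map_add]
    have := AlgLimit.sInf_le φ i (x + y)
    have := norm_add_le x y
    linarith
  neg' z := by
    congr 1
    ext r
    constructor
    · rintro ⟨i, x, hx, rfl⟩; exact ⟨i, -x, by rw [map_neg, hx, neg_neg], (norm_neg x).symm⟩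
    · rintro ⟨i, x, hx, rfl⟩; exact ⟨i, -x, by rw [map_neg, hx], (norm_neg x).symm⟩
  mul_le' z w := by
    have key : ∀ ε > 0, sInf (AlgLimit.normSet φ (z * w)) ≤
        (sInf (AlgLimit.normSet φ z) + ε) * (sInf (AlgLimit.normSet φ w) + ε) := by
      intro ε hε
      obtain ⟨i, x, y, hx0, hy0, hx, hy⟩ := AlgLimit.exists_lt₂ φ z w hε
      have h1 := AlgLimit.sInf_le φ i (x * y)
      rw [map_mul, hx0, hy0] at h1
      exact h1.trans ((norm_mul_le x y).trans
        (mul_le_mul hx.le hy.le (norm_nonneg _) ((norm_nonneg _).trans hx.le)))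
    have hcont : Tendsto (fun ε : ℝ => (sInf (AlgLimit.normSet φ z) + ε) *
        (sInf (AlgLimit.normSet φ w) + ε)) (𝓝[>] 0)
        (𝓝 ((sInf (AlgLimit.normSet φ z) + 0) * (sInf (AlgLimit.normSet φ w) + 0))) :=
      (Continuous.tendsto (by fun_prop) 0).mono_left nhdsWithin_le_nhds
    rw [add_zero, add_zero] at hcont
    exact ge_of_tendsto hcont (eventually_nhdsWithin_of_forall fun ε hε => key ε hε)

instance : SeminormedRing (AlgLimit φ) := (AlgLimit.ringSeminorm φ).toSeminormedRing

theorem AlgLimit.norm_def (z : AlgLimit φ) : ‖z‖ = sInf (AlgLimit.normSet φ z) := rfl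

theorem AlgLimit.norm_of_le (i : ℕ) (x : X i) : ‖AlgLimit.of φ i x‖ ≤ ‖x‖ := AlgLimit.sInf_le φ i x

instance : NormedAlgebra ℂ (AlgLimit φ) where
  norm_smul_le c z := le_of_forall_pos_le_add fun ε hε => by
    obtain ⟨i, x, hx, hlt⟩ := AlgLimit.exists_lt φ z
      (show 0 < ε / (‖c‖ + 1) by positivity)
    rw [← AlgLimit.norm_def] at hlt
    have h1 := AlgLimit.norm_of_le φ i (c • x)
    rw [map_smul, hx] at h1
    have h2 : ‖c‖ * (ε / (‖c‖ + 1)) ≤ ε := by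
      rw [mul_div_assoc', div_le_iff₀ (by positivity)]
      nlinarith [norm_nonneg c]
    calc ‖c • z‖ ≤ ‖c • x‖ := h1
      _ = ‖c‖ * ‖x‖ := norm_smul c x
      _ ≤ ‖c‖ * (‖z‖ + ε / (‖c‖ + 1)) := by gcongr
      _ ≤ ‖c‖ * ‖z‖ + ε := by rw [mul_add]; gcongr

instance : NormedStarGroup (AlgLimit φ) where
  norm_star_le z := le_of_forall_pos_le_add fun ε hε => by
    obtain ⟨i, x, hx, hlt⟩ := AlgLimit.exists_lt φ z hε
    have h1 := AlgLimit.norm_of_le φ i (star x)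
    rw [map_star, hx, norm_star x] at h1
    exact h1.trans hlt.le

theorem AlgLimit.norm_mul_self_le (z : AlgLimit φ) : ‖z‖ * ‖z‖ ≤ ‖star z * z‖ := by
  refine le_of_forall_pos_le_add fun ε hε => ?_
  obtain ⟨i, y, hy, hlt⟩ := AlgLimit.exists_lt φ (star z * z) hε
  obtain ⟨j, x, rfl⟩ := AlgLimit.exists_of φ z
  rw [← map_star, ← map_mul, AlgLimit.of_eq_iff] at hy
  obtain ⟨k, hi, hj, h⟩ := hy
  have h1 : ‖AlgLimit.of φ j x‖ ≤ ‖seqMap φ j k hj x‖ := by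
    rw [← AlgLimit.of_seqMap φ j k hj]; exact AlgLimit.norm_of_le φ _ _
  have h2 : ‖seqMap φ j k hj x‖ * ‖seqMap φ j k hj x‖ ≤ ‖y‖ := by
    rw [← CStarRing.norm_star_mul_self, ← map_star, ← map_mul, ← h]
    exact seqMap_norm_le φ _ _ _ _
  exact (mul_le_mul h1 h1 (norm_nonneg _) (norm_nonneg _)).trans (h2.trans hlt.le)

/-- The C⋆-inductive limit: the (Hausdorff) completion of the algebraic direct limit. -/
def CStarLimit : Type := UniformSpace.Completion (AlgLimit φ)

namespace CStarLimit

instance : NormedRing (CStarLimit φ) :=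
  inferInstanceAs (NormedRing (UniformSpace.Completion (AlgLimit φ)))

instance : CompleteSpace (CStarLimit φ) :=
  inferInstanceAs (CompleteSpace (UniformSpace.Completion (AlgLimit φ)))

instance : NormedAlgebra ℂ (CStarLimit φ) where
  toAlgebra := inferInstanceAs (Algebra ℂ (UniformSpace.Completion (AlgLimit φ)))
  norm_smul_le := norm_smul_le (β := UniformSpace.Completion (AlgLimit φ))

/-- The canonical map from the algebraic direct limit into its completion. -/
def coe (z : AlgLimit φ) : CStarLimit φ := (z : UniformSpace.Completion (AlgLimit φ))

theorem denseRange_coe : DenseRange (coe φ) := UniformSpace.Completion.denseRange_coe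

theorem continuous_coe : Continuous (coe φ) := UniformSpace.Completion.continuous_coe _

theorem norm_coe (z : AlgLimit φ) : ‖coe φ z‖ = ‖z‖ := UniformSpace.Completion.norm_coe z

theorem coe_add (z w : AlgLimit φ) : coe φ (z + w) = coe φ z + coe φ w :=
  UniformSpace.Completion.coe_add z w

theorem coe_mul (z w : AlgLimit φ) : coe φ (z * w) = coe φ z * coe φ w :=
  UniformSpace.Completion.coe_mul z w

theorem coe_smul (c : ℂ) (z : AlgLimit φ) : coe φ (c • z) = c • coe φ z :=
  UniformSpace.Completion.coe_smul c z

instance : Star (CStarLimit φ) :=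
  ⟨(UniformSpace.Completion.map star :
    UniformSpace.Completion (AlgLimit φ) → UniformSpace.Completion (AlgLimit φ))⟩

theorem uniformContinuous_star : UniformContinuous (star : AlgLimit φ → AlgLimit φ) :=
  (starₗᵢ ℂ : AlgLimit φ ≃ₗᵢ⋆[ℂ] AlgLimit φ).isometry.uniformContinuous

theorem continuous_star' : Continuous (star : CStarLimit φ → CStarLimit φ) :=
  UniformSpace.Completion.continuous_map

theorem star_coe (z : AlgLimit φ) : star (coe φ z) = coe φ (star z) :=
  UniformSpace.Completion.map_coe (uniformContinuous_star φ) z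

instance : StarRing (CStarLimit φ) where
  star_involutive x := by
    have hs := continuous_star' φ
    refine (denseRange_coe φ).induction_on x (isClosed_eq (by fun_prop) (by fun_prop)) fun z => ?_
    rw [star_coe, star_coe, star_star]
  star_mul x y := by
    have hs := continuous_star' φ
    refine (denseRange_coe φ).induction_on₂ (isClosed_eq (by fun_prop) (by fun_prop))
      (fun z w => ?_) x y
    rw [← coe_mul, star_coe, star_coe, star_coe, star_mul, coe_mul]
  star_add x y := by
    have hs := continuous_star' φ
    refine (denseRange_coe φ).induction_on₂ (isClosed_eq (by fun_prop) (by fun_prop))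
      (fun z w => ?_) x y
    rw [← coe_add, star_coe, star_coe, star_coe, star_add, coe_add]

instance : StarModule ℂ (CStarLimit φ) where
  star_smul c x := by
    have hs := continuous_star' φ
    refine (denseRange_coe φ).induction_on x (isClosed_eq (hs.comp (continuous_const_smul c))
      (hs.const_smul (star c))) fun z => ?_
    rw [← coe_smul, star_coe, star_coe, star_smul, coe_smul]

instance : CStarRing (CStarLimit φ) where
  norm_mul_self_le x := by
    have hs := continuous_star' φ
    refine (denseRange_coe φ).induction_on x (isClosed_le (by fun_prop) (by fun_prop)) fun z => ?_
    rw [star_coe, ← coe_mul, norm_coe, norm_coe]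
    exact AlgLimit.norm_mul_self_le φ z

instance : CStarAlgebra (CStarLimit φ) where

/-- The canonical morphism `φ_{i,∞}` of the `i`-th algebra into the inductive limit. -/
def of (i : ℕ) : X i →⋆ₐ[ℂ] CStarLimit φ where
  toFun x := coe φ (AlgLimit.of φ i x)
  map_one' := by rw [map_one]; rfl
  map_mul' x y := by rw [map_mul, coe_mul]
  map_zero' := by rw [map_zero]; rfl
  map_add' x y := by rw [map_add, coe_add]
  commutes' c := by
    rw [Algebra.algebraMap_eq_smul_one, Algebra.algebraMap_eq_smul_one, map_smul, coe_smul, map_one]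
    rfl
  map_star' x := by rw [map_star, star_coe]

end CStarLimit

end Limit

/-! ### The UHF algebra `M`, its trace, and the GNS filtration -/

/-- The `n × n` complex matrices (with the operator norm). -/
abbrev Mat (n : ℕ) : Type := Matrix (Fin n) (Fin n) ℂ

/-- The block-diagonal matrix `diag(a_0, …, a_{l-1})` with blocks `a_s` of size `n`. -/
def blockDiag (l n : ℕ) : (Fin l → Mat n) →⋆ₐ[ℂ] Mat (l * n) where
  toFun a := (Matrix.blockDiagonal a).submatrix
    (fun p => (finProdFinEquiv.symm p).swap) (fun p => (finProdFinEquiv.symm p).swap)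
  map_one' := by
    rw [Matrix.blockDiagonal_one]
    exact Matrix.submatrix_one_equiv (finProdFinEquiv.symm.trans (Equiv.prodComm _ _))
  map_mul' a b := by
    have h : Matrix.blockDiagonal (a * b) = Matrix.blockDiagonal a * Matrix.blockDiagonal b :=
      Matrix.blockDiagonal_mul a b
    rw [h]
    exact (Matrix.submatrix_mul_equiv _ _ _
      (finProdFinEquiv.symm.trans (Equiv.prodComm _ _)) _).symm
  map_zero' := by rw [Matrix.blockDiagonal_zero]; rfl
  map_add' a b := by rw [Matrix.blockDiagonal_add]; rfl
  commutes' c := by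
    have h : Matrix.blockDiagonal (algebraMap ℂ (Fin l → Mat n) c) = c • 1 := by
      rw [Algebra.algebraMap_eq_smul_one, Matrix.blockDiagonal_smul, Matrix.blockDiagonal_one]
    rw [h, Algebra.algebraMap_eq_smul_one, ← Matrix.submatrix_one_equiv
      (finProdFinEquiv.symm.trans (Equiv.prodComm (Fin l) (Fin n)))]
    rfl
  map_star' a := by
    have h : Matrix.blockDiagonal (star a) = (Matrix.blockDiagonal a).conjTranspose :=
      (Matrix.blockDiagonal_conjTranspose a).symm
    rw [h]
    rfl

theorem trace_blockDiag (l n : ℕ) (a : Fin l → Mat n) :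
    (blockDiag l n a).trace = ∑ s, (a s).trace := by
  rw [← Matrix.trace_blockDiagonal]
  exact Equiv.sum_comp (finProdFinEquiv.symm.trans (Equiv.prodComm _ _))
    (fun p => Matrix.blockDiagonal a p p)

/-- The matrix sizes: `n_0 = 1` and `n_{i+1} = l_i n_i`. -/
def dim (l : ℕ → ℕ+) : ℕ → ℕ
  | 0 => 1
  | i + 1 => (l i : ℕ) * dim l i

theorem dim_pos (l : ℕ → ℕ+) (i : ℕ) : 0 < dim l i := by
  induction i with
  | zero => exact Nat.one_pos
  | succ i ih => exact Nat.mul_pos (l i).pos ih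

/-- `ψ_i(a) = a ⊗ 1 = diag(a, …, a)`, from `M_{n_i}` to `M_{n_{i+1}}`. -/
def ampl (l : ℕ → ℕ+) (i : ℕ) : Mat (dim l i) →⋆ₐ[ℂ] Mat (dim l (i + 1)) where
  toFun a := blockDiag (l i) (dim l i) (fun _ => a)
  map_one' := map_one (blockDiag (l i) (dim l i))
  map_mul' a b := map_mul (blockDiag (l i) (dim l i)) (fun _ => a) (fun _ => b)
  map_zero' := map_zero (blockDiag (l i) (dim l i))
  map_add' a b := map_add (blockDiag (l i) (dim l i)) (fun _ => a) (fun _ => b)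
  commutes' c := AlgHomClass.commutes (blockDiag (l i) (dim l i)) c
  map_star' a := map_star (blockDiag (l i) (dim l i)) (fun _ => a)

/-- The UHF algebra `M = lim (M_{n_i}, ψ_i)`. -/
abbrev UHF (l : ℕ → ℕ+) : Type := CStarLimit (ampl l)

instance (l : ℕ → ℕ+) : PartialOrder (UHF l) := CStarAlgebra.spectralOrder _
instance (l : ℕ → ℕ+) : StarOrderedRing (UHF l) := CStarAlgebra.spectralOrderedRing _

/-- The normalized trace of `M_{n_i}`. -/
def normTrace (l : ℕ → ℕ+) (i : ℕ) : Mat (dim l i) →ₗ[ℂ] ℂ :=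
  ((dim l i : ℂ)⁻¹) • Matrix.traceLinearMap (Fin (dim l i)) ℂ ℂ

theorem normTrace_apply (l : ℕ → ℕ+) (i : ℕ) (a : Mat (dim l i)) :
    normTrace l i a = (dim l i : ℂ)⁻¹ * a.trace := rfl

theorem normTrace_ampl (l : ℕ → ℕ+) (i : ℕ) (a : Mat (dim l i)) :
    normTrace l (i + 1) (ampl l i a) = normTrace l i a := by
  have h1 : (ampl l i a).trace = (l i : ℂ) * a.trace := by
    refine (trace_blockDiag (l i) (dim l i) (fun _ => a)).trans ?_
    simp
  have h2 : ((l i : ℕ) : ℂ) ≠ 0 := by exact_mod_cast (l i).pos.ne'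
  have h3 : ((dim l i : ℕ) : ℂ) ≠ 0 := by exact_mod_cast (dim_pos l i).ne'
  rw [normTrace_apply, normTrace_apply, h1]
  have h4 : ((dim l (i + 1) : ℕ) : ℂ) = (l i : ℂ) * dim l i := by simp [dim]
  rw [h4]
  field_simp

theorem normTrace_seqMap (l : ℕ → ℕ+) (i j : ℕ) (h : i ≤ j) (a : Mat (dim l i)) :
    normTrace l j (seqMap (ampl l) i j h a) = normTrace l i a := by
  induction j, h using Nat.le_induction with
  | base => rw [seqMap_self]; rfl
  | succ j h ih => rw [seqMap_succ (ampl l) i j h, StarAlgHom.comp_apply, normTrace_ampl, ih]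

theorem norm_normTrace_le (l : ℕ → ℕ+) (i : ℕ) (a : Mat (dim l i)) : ‖normTrace l i a‖ ≤ ‖a‖ := by
  have hd : (0 : ℝ) < dim l i := by exact_mod_cast dim_pos l i
  have hentry : ∀ k, ‖a k k‖ ≤ ‖a‖ := by
    intro k
    have h1 := Matrix.l2_opNorm_mulVec a (EuclideanSpace.single k (1 : ℂ))
    have h2 := PiLp.norm_apply_le
      (WithLp.toLp 2 (a.mulVec (EuclideanSpace.single k (1 : ℂ)).ofLp)) k
    simp at h1 h2
    exact h2.trans h1
  rw [normTrace_apply, norm_mul, norm_inv, Complex.norm_natCast, inv_mul_le_iff₀ hd]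
  calc ‖a.trace‖ ≤ ∑ k, ‖a k k‖ := norm_sum_le _ _
    _ ≤ ∑ _k : Fin (dim l i), ‖a‖ := Finset.sum_le_sum fun k _ => hentry k
    _ = dim l i * ‖a‖ := by simp

/-- The trace on the algebraic direct limit of the matrix algebras. -/
def algTraceFun (l : ℕ → ℕ+) (z : AlgLimit (ampl l)) : ℂ :=
  DirectLimit.lift (seqMap (ampl l)) (fun i a => normTrace l i a)
    (fun i j h a => (normTrace_seqMap l i j h a).symm) z

theorem algTraceFun_of (l : ℕ → ℕ+) (i : ℕ) (a : Mat (dim l i)) :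
    algTraceFun l (AlgLimit.of (ampl l) i a) = normTrace l i a := rfl

/-- The trace on the algebraic direct limit, as a continuous linear map. -/
def algTrace (l : ℕ → ℕ+) : AlgLimit (ampl l) →L[ℂ] ℂ :=
  LinearMap.mkContinuous
    { toFun := algTraceFun l
      map_add' := fun z w => by
        obtain ⟨i, x, y, rfl, rfl, -, -⟩ := AlgLimit.exists_lt₂ (ampl l) z w one_pos
        rw [← map_add, algTraceFun_of, algTraceFun_of, algTraceFun_of, map_add]
      map_smul' := fun c z => by
        obtain ⟨i, x, rfl⟩ := AlgLimit.exists_of (ampl l) z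
        rw [← map_smul, algTraceFun_of, algTraceFun_of, map_smul, RingHom.id_apply] }
    1 fun z => by
      rw [one_mul]
      refine le_of_forall_pos_le_add fun ε hε => ?_
      obtain ⟨i, x, hx, hlt⟩ := AlgLimit.exists_lt (ampl l) z hε
      have h : algTraceFun l z = normTrace l i x := by rw [← hx, algTraceFun_of]
      change ‖algTraceFun l z‖ ≤ _
      rw [h]
      exact (norm_normTrace_le l i x).trans hlt.le

/-- The canonical map into the completion, as a continuous linear map. -/
def limitCoeL (l : ℕ → ℕ+) : AlgLimit (ampl l) →L[ℂ] UHF l where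
  toFun := CStarLimit.coe (ampl l)
  map_add' := CStarLimit.coe_add (ampl l)
  map_smul' := CStarLimit.coe_smul (ampl l)
  cont := CStarLimit.continuous_coe (ampl l)

/-- The continuous extension of the normalized traces to `M`. -/
def traceL (l : ℕ → ℕ+) : UHF l →L[ℂ] ℂ := (algTrace l).extend (limitCoeL l)

theorem traceL_coe (l : ℕ → ℕ+) (z : AlgLimit (ampl l)) :
    traceL l (CStarLimit.coe (ampl l) z) = algTraceFun l z :=
  ContinuousLinearMap.extend_eq (algTrace l) (e := limitCoeL l) (CStarLimit.denseRange_coe (ampl l))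
    (UniformSpace.Completion.isUniformInducing_coe _) z

open scoped ComplexOrder

theorem traceL_star_mul_self (l : ℕ → ℕ+) (x : UHF l) : 0 ≤ traceL l (star x * x) := by
  refine (CStarLimit.denseRange_coe (ampl l)).induction_on x
    (isClosed_le continuous_const (by fun_prop)) fun z => ?_
  obtain ⟨i, a, rfl⟩ := AlgLimit.exists_of (ampl l) z
  rw [CStarLimit.star_coe, ← CStarLimit.coe_mul, traceL_coe, ← map_star, ← map_mul, algTraceFun_of,
    normTrace_apply]
  refine mul_nonneg (inv_nonneg.mpr (Nat.cast_nonneg _)) ?_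
  exact (Matrix.posSemidef_conjTranspose_mul_self a).trace_nonneg

/-- The trace `τ` of the UHF algebra `M`: the state which restricts to the normalized trace on each
`M_{n_i}`. -/
def uhfTrace (l : ℕ → ℕ+) : UHF l →ₚ[ℂ] ℂ :=
  PositiveLinearMap.mk₀ (traceL l).toLinearMap fun x hx => by
    obtain ⟨y, rfl⟩ := CStarAlgebra.nonneg_iff_eq_star_mul_self.mp hx
    exact traceL_star_mul_self l y

theorem uhfTrace_of (l : ℕ → ℕ+) (i : ℕ) (a : Mat (dim l i)) :
    uhfTrace l (CStarLimit.of (ampl l) i a) = (dim l i : ℂ)⁻¹ * a.trace :=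
  traceL_coe l _

/-- The GNS Hilbert space `𝔥` of the trace of `M`. -/
abbrev GNSSpace (l : ℕ → ℕ+) : Type := (uhfTrace l).GNS

/-- The map `M_{n_i} → 𝔥`. -/
def gnsIncl (l : ℕ → ℕ+) (i : ℕ) : Mat (dim l i) →ₗ[ℂ] GNSSpace l :=
  (UniformSpace.Completion.toComplL : (uhfTrace l).PreGNS →L[ℂ] GNSSpace l).toLinearMap ∘ₗ
    (uhfTrace l).toPreGNS.toLinearMap ∘ₗ (CStarLimit.of (ampl l) i).toAlgHom.toLinearMap

/-- The finite-dimensional subspace `𝔥_i` of `𝔥`, the copy of `M_{n_i}`. -/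
def gnsStage (l : ℕ → ℕ+) (i : ℕ) : Submodule ℂ (GNSSpace l) := LinearMap.range (gnsIncl l i)

instance (l : ℕ → ℕ+) (i : ℕ) : FiniteDimensional ℂ (gnsStage l i) :=
  inferInstanceAs (FiniteDimensional ℂ (LinearMap.range (gnsIncl l i)))

theorem gnsIncl_seqMap (l : ℕ → ℕ+) (i j : ℕ) (h : i ≤ j) (a : Mat (dim l i)) :
    gnsIncl l j (seqMap (ampl l) i j h a) = gnsIncl l i a := by
  have : CStarLimit.of (ampl l) j (seqMap (ampl l) i j h a) = CStarLimit.of (ampl l) i a :=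
    congrArg (CStarLimit.coe (ampl l)) (AlgLimit.of_seqMap (ampl l) i j h a)
  exact congrArg (fun x => (((uhfTrace l).toPreGNS x : (uhfTrace l).PreGNS) : GNSSpace l)) this

theorem gnsStage_mono (l : ℕ → ℕ+) : Monotone (gnsStage l) := by
  rintro i j h _ ⟨a, rfl⟩
  exact ⟨seqMap (ampl l) i j h a, gnsIncl_seqMap l i j h a⟩

/-! ### The operator `D = ∑ α_n Q_n` of an increasing sequence of subspaces -/

section Dirac

variable {H : Type} [NormedAddCommGroup H] [InnerProductSpace ℂ H]

/-- The increments `K_0 = F_0`, `K_n = F_n ⊖ F_{n-1}` of a sequence of subspaces. -/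
def layer (F : ℕ → Submodule ℂ H) : ℕ → Submodule ℂ H
  | 0 => F 0
  | n + 1 => F (n + 1) ⊓ (F n)ᗮ

theorem layer_le (F : ℕ → Submodule ℂ H) (n : ℕ) : layer F n ≤ F n := by
  cases n with
  | zero => exact le_rfl
  | succ n => exact inf_le_left

instance (F : ℕ → Submodule ℂ H) [∀ n, FiniteDimensional ℂ (F n)] (n : ℕ) :
    FiniteDimensional ℂ (layer F n) :=
  Submodule.finiteDimensional_of_le (layer_le F n)

theorem layer_isOrtho (F : ℕ → Submodule ℂ H) (hF : Monotone F) {m n : ℕ} (h : m < n) :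
    layer F m ⟂ layer F n := by
  cases n with
  | zero => exact absurd h (Nat.not_lt_zero m)
  | succ n =>
    have h1 : layer F m ≤ F n := (layer_le F m).trans (hF (Nat.lt_succ_iff.mp h))
    exact (Submodule.isOrtho_orthogonal_right (F n)).mono h1 inf_le_right

theorem layer_orthogonalFamily (F : ℕ → Submodule ℂ H) (hF : Monotone F) :
    OrthogonalFamily ℂ (fun n => layer F n) fun n => (layer F n).subtypeₗᵢ :=
  OrthogonalFamily.of_pairwise fun m n hmn => by
    rcases lt_or_gt_of_ne hmn with h | h
    · exact layer_isOrtho F hF h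
    · exact (layer_isOrtho F hF h).symm

variable (F : ℕ → Submodule ℂ H) [∀ n, FiniteDimensional ℂ (F n)]

/-- The orthogonal projection `Q_n` of `H` onto `K_n`. -/
def layerProj (n : ℕ) : H →L[ℂ] H := (layer F n).starProjection

variable [CompleteSpace H]

theorem summable_layerProj (hF : Monotone F) (α : ℕ → ℝ) {v : H}
    (hv : Summable fun n => ‖(α n : ℂ) • layerProj F n v‖ ^ 2) :
    Summable fun n => (α n : ℂ) • layerProj F n v :=
  ((layer_orthogonalFamily F hF).summable_iff_norm_sq_summable
    (fun n => (α n : ℂ) • (layer F n).orthogonalProjectionOnto v)).mpr hv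

/-- The unbounded operator `D = ∑ α_n Q_n` with domain `{v | (‖α_n Q_n v‖)_n ∈ ℓ²}`. -/
def diracOp (hF : Monotone F) (α : ℕ → ℝ) : H →ₗ.[ℂ] H where
  domain :=
    { carrier := {v | Summable fun n => ‖(α n : ℂ) • layerProj F n v‖ ^ 2}
      add_mem' := fun {v w} hv hw => by
        refine Summable.of_nonneg_of_le (fun n => by positivity) (fun n => ?_)
          ((hv.add hw).mul_left 2)
        rw [map_add, smul_add]
        exact (pow_le_pow_left₀ (norm_nonneg _) (norm_add_le _ _) 2).trans add_sq_le
      zero_mem' := by simp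
      smul_mem' := fun c v hv => by
        refine (hv.mul_left (‖c‖ ^ 2)).congr fun n => ?_
        rw [map_smul, smul_comm, norm_smul c, mul_pow] }
  toFun :=
    { toFun := fun v => ∑' n, (α n : ℂ) • layerProj F n v.1
      map_add' := fun v w => by
        rw [← (summable_layerProj F hF α v.2).tsum_add (summable_layerProj F hF α w.2)]
        exact tsum_congr fun n => by rw [Submodule.coe_add, map_add, smul_add]
      map_smul' := fun c v => by
        rw [RingHom.id_apply, ← (summable_layerProj F hF α v.2).tsum_const_smul c]
        exact tsum_congr fun n => by rw [Submodule.coe_smul, map_smul, smul_comm] }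

end Dirac

/-! ### Spectral triples -/

section SpectralTriple

variable {H : Type} [NormedAddCommGroup H] [InnerProductSpace ℂ H] [CompleteSpace H]

/-- `D` has compact resolvent: `(D - z)⁻¹` exists and is a compact operator, for every non-real `z`.
-/
def HasCompactResolvent (D : H →ₗ.[ℂ] H) : Prop :=
  ∀ z : ℂ, z.im ≠ 0 → ∃ R : H →L[ℂ] H, IsCompactOperator R ∧
    (∀ v : H, ∃ h : R v ∈ D.domain, D ⟨R v, h⟩ - z • R v = v) ∧
    (∀ x : D.domain, R (D x - z • (x : H)) = x)

/-- `(𝒜, H, D)` is a spectral triple for the C⋆-algebra `B`, where `B` acts on the Hilbert space `H`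
through the faithful unital representation `π`. -/
structure IsSpectralTriple {B : Type} [CStarAlgebra B] (𝒜 : StarSubalgebra ℂ B)
    (π : B →⋆ₐ[ℂ] (H →L[ℂ] H)) (D : H →ₗ.[ℂ] H) : Prop where
  dense : Dense (𝒜 : Set B)
  faithful : Function.Injective π
  selfAdjoint : IsSelfAdjoint D
  compact_resolvent : HasCompactResolvent D
  mem_domain : ∀ a ∈ 𝒜, ∀ x ∈ D.domain, π a x ∈ D.domain
  bounded_commutator : ∀ a ∈ 𝒜, ∃ T : H →L[ℂ] H, ∀ x : D.domain, ∀ h : π a x ∈ D.domain,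
    D ⟨π a x, h⟩ - π a (D x) = T x

/-- `p`-summability, `Tr((1 + D²)^{-p/2}) < ∞`: there is an orthonormal basis of eigenvectors of
`D`, with eigenvalues `ev`, for which the sum `∑_k (1 + ev_k²)^{-p/2}` is finite. -/
def IsPSummable (D : H →ₗ.[ℂ] H) (p : ℝ) : Prop :=
  ∃ (κ : Type) (b : HilbertBasis κ ℂ H) (ev : κ → ℝ),
    (∀ k, ∃ h : b k ∈ D.domain, D ⟨b k, h⟩ = (ev k : ℂ) • b k) ∧
    Summable fun k => (1 + ev k ^ 2) ^ (-p / 2)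

end SpectralTriple

/-! ### Inductive systems of subalgebras of `C([0,1], M_{n_i})` -/

/-- The diagonal morphism `f ↦ diag(f ∘ ξ_0, …, f ∘ ξ_{l-1})`. -/
def diagHom {l n : ℕ} (ξ : Fin l → C(I, I)) : C(I, Mat n) →⋆ₐ[ℂ] C(I, Mat (l * n)) where
  toFun f := ⟨fun t => blockDiag l n fun s => f (ξ s t), by
    refine Continuous.matrix_submatrix (Continuous.matrix_blockDiagonal ?_) _ _
    fun_prop⟩
  map_one' := by ext1 t; exact map_one (blockDiag l n)
  map_mul' f g := by
    ext1 t; exact map_mul (blockDiag l n) (fun s => f (ξ s t)) (fun s => g (ξ s t))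
  map_zero' := by ext1 t; exact map_zero (blockDiag l n)
  map_add' f g := by
    ext1 t; exact map_add (blockDiag l n) (fun s => f (ξ s t)) (fun s => g (ξ s t))
  commutes' c := by ext1 t; exact AlgHomClass.commutes (blockDiag l n) c
  map_star' f := by ext1 t; exact map_star (blockDiag l n) (fun s => f (ξ s t))

/-- The untwisted morphism from `C([0,1], M_{n_i})` to `C([0,1], M_{n_{i+1}})`. -/
def untwistedHom {l : ℕ → ℕ+} (ξ : ∀ i, Fin (l i) → C(I, I)) (i : ℕ) :
    C(I, Mat (dim l i)) →⋆ₐ[ℂ] C(I, Mat (dim l (i + 1))) := diagHom (ξ i)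

/-- The paths occurring in the composite connecting morphism from stage `i` to stage `i + d`, for
one-step paths `ξ`. -/
def pathSet {l : ℕ → ℕ+} (ξ : ∀ i, Fin (l i) → C(I, I)) (i : ℕ) : ℕ → Set C(I, I)
  | 0 => {ContinuousMap.id I}
  | d + 1 => {η | ∃ ζ ∈ pathSet ξ i d, ∃ s, η = ζ.comp (ξ (i + d) s)}

/-- `f` is Lipschitz with Lipschitz constant at most `C`. -/
def LipschitzBound {E : Type} [PseudoMetricSpace E] (C : ℝ) (f : C(I, E)) : Prop :=
  ∀ x y : I, dist (f x) (f y) ≤ C * |(x : ℝ) - y|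

/-- A sequence of unital C⋆-subalgebras `B_i` of `C([0,1], M_{n_i})`, where `n_0 = 1` and
`n_{i+1} = l_i n_i`, whose connecting morphisms are conjugates by unitaries of diagonal morphisms.
A path with multiplicity `N` is listed `N` times, so that
`diag(f ∘ ξ_1 ⊗ 1_{N_1}, …, f ∘ ξ_k ⊗ 1_{N_k})` is `diagHom` of a family of `l = N_1 + ⋯ + N_k`
paths. -/
structure IntervalSystem where
  /-- the ratios `n_{i+1} / n_i` -/
  l : ℕ → ℕ+
  /-- the paths, listed with multiplicity -/
  ξ : ∀ i, Fin (l i) → C(I, I)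
  /-- the unitaries -/
  u : ∀ i, unitary C(I, Mat (dim l (i + 1)))
  /-- the algebras `B_i` -/
  B : ∀ i, StarSubalgebra ℂ C(I, Mat (dim l i))
  isClosed_B : ∀ i, IsClosed (B i : Set C(I, Mat (dim l i)))
  /-- `B_0 = ℂ` -/
  B_zero : B 0 = ⊥
  /-- the connecting morphisms map `B_i` into `B_{i+1}` -/
  map_mem : ∀ i, ∀ f ∈ B i, (u i : C(I, Mat (dim l (i + 1)))) * untwistedHom ξ i f *
    star (u i : C(I, Mat (dim l (i + 1)))) ∈ B (i + 1)
  /-- the Lipschitz functions are dense in `B_i` -/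
  dense_lipschitz : ∀ i, (B i : Set C(I, Mat (dim l i))) ⊆
    closure {f | f ∈ B i ∧ ∃ C, LipschitzBound C f}
  /-- the paths of the connecting morphism from stage `i` to stage `i + d` oscillate by at most
  `2^{-d}` -/
  oscillation : ∀ i d, ∀ η ∈ pathSet ξ i d, ∀ x y : I, |(η x : ℝ) - η y| ≤ (1 / 2) ^ d

namespace IntervalSystem

variable (S : IntervalSystem)

/-- The matrix sizes `n_i`. -/
abbrev n (i : ℕ) : ℕ := dim S.l i

/-- The untwisted morphism from `C([0,1], M_{n_i})` to `C([0,1], M_{n_{i+1}})`. -/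
def untwisted (i : ℕ) : C(I, Mat (S.n i)) →⋆ₐ[ℂ] C(I, Mat (S.n (i + 1))) :=
  untwistedHom S.ξ i

/-- The C⋆-algebra `B_i` as a type. -/
def Stage (i : ℕ) : Type := S.B i

instance (i : ℕ) : CStarAlgebra (S.Stage i) :=
  haveI : IsClosed (S.B i : Set C(I, Mat (S.n i))) := S.isClosed_B i
  inferInstanceAs (CStarAlgebra (S.B i))

/-- The inclusion of `B_i` in `C([0,1], M_{n_i})`. -/
def toFunction (i : ℕ) : S.Stage i →⋆ₐ[ℂ] C(I, Mat (S.n i)) := (S.B i).subtype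

/-- The twisted morphism `f ↦ u_i diag(f ∘ ξ_s) u_i⋆` on all of `C([0,1], M_{n_i})`. -/
def twisted (i : ℕ) : C(I, Mat (S.n i)) →⋆ₐ[ℂ] C(I, Mat (S.n (i + 1))) :=
  (Unitary.conjStarAlgAut ℂ C(I, Mat (S.n (i + 1))) (S.u i) :
    C(I, Mat (S.n (i + 1))) →⋆ₐ[ℂ] C(I, Mat (S.n (i + 1)))).comp (S.untwisted i)

/-- The connecting morphism `φ_i(f) = u_i diag(f ∘ ξ_s) u_i⋆` from `B_i` to `B_{i+1}`. -/
def conn (i : ℕ) : S.Stage i →⋆ₐ[ℂ] S.Stage (i + 1) :=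
  ((S.twisted i).comp (S.B i).subtype).codRestrict (S.B (i + 1)) fun f => S.map_mem i f.1 f.2

theorem toFunction_conn (i : ℕ) (f : S.Stage i) :
    S.toFunction (i + 1) (S.conn i f) = (S.u i : C(I, Mat (S.n (i + 1)))) *
      S.untwisted i (S.toFunction i f) * star (S.u i : C(I, Mat (S.n (i + 1)))) := rfl

/-- The inductive limit `B = lim (B_i, φ_i)`. -/
abbrev limit : Type := CStarLimit S.conn

/-- The canonical morphism `φ_{i,∞}` of `B_i` into the inductive limit `B`. -/
def incl (i : ℕ) : S.Stage i →⋆ₐ[ℂ] S.limit := CStarLimit.of S.conn i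

/-- The unitary `u_{0,i}` of the composite connecting morphism `φ_{0,i} = u_{0,i} φ̃_{0,i} u_{0,i}⋆`,
where `φ̃_{0,i}` is the composite of the untwisted morphisms. -/
def totalUnitary : ∀ i, C(I, Mat (S.n i))
  | 0 => 1
  | i + 1 => (S.u i : C(I, Mat (S.n (i + 1)))) * S.untwisted i (totalUnitary i)

/-- For `f ∈ B_i`, the function `f̃` with `f = u_{0,i} f̃ u_{0,i}⋆`. -/
def untwist (i : ℕ) (f : C(I, Mat (S.n i))) : C(I, Mat (S.n i)) :=
  star (S.totalUnitary i) * f * S.totalUnitary i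

/-- The defining property of the AF-embedding `ι : B → M`: for `f ∈ B_i`, the image in `M` of the
matrices `φ̃_{i,m}(f̃)(0)` converge to `ι(φ_{i,∞}(f))` as `m → ∞`. -/
def IsAFEmbedding (ι : S.limit →⋆ₐ[ℂ] UHF S.l) : Prop :=
  Function.Injective ι ∧ ∀ (i : ℕ) (f : S.Stage i),
    Tendsto (fun d : ℕ => CStarLimit.of (ampl S.l) (i + d)
        (seqMap S.untwisted i (i + d) (Nat.le_add_right i d) (S.untwist i (S.toFunction i f)) 0))
      atTop (𝓝 (ι (S.incl i f)))

/-- `LB_i`: the functions in `B_i` whose Lipschitz constant is smaller than `γ^i`. -/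
def LB (γ : ℝ) (i : ℕ) : Set (S.Stage i) :=
  {f | ∃ C < γ ^ i, LipschitzBound C (S.toFunction i f)}

/-- The union `⋃_i LB_i` inside the inductive limit `B`. -/
def LBUnion (γ : ℝ) : Set S.limit := ⋃ i, S.incl i '' S.LB γ i

end IntervalSystem

end

/-!
Write `Q_n` for `layerProj`, `P_n` for the projection onto `F n = 𝔥_{r(n)}`, and
`D = ∑ α_n Q_n` for `diracOp`. The layers are finite-dimensional, pairwise orthogonal and, since the
matrices are dense in `M`, total in `𝔥`. Hence a vector `v` lies in the domain of `D` with `D v = w`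
exactly when `Q_n w = α_n Q_n v` for all `n` (`layerProj_diracOp`, `diracOp_of_layerProj`). This
criterion gives self-adjointness, identifies the resolvent with the norm-convergent series
`∑ (α_n - z)⁻¹ Q_n` of finite-rank operators, and makes every orthonormal basis adapted to the layers
a basis of eigenvectors; as the trace is faithful on matrices, the `n`-th layer has dimension
`n_{r(n)}² - n_{r(n-1)}²`, whence the summability statement.

The embedding. The morphisms `f ↦ f̃` intertwine `φ_i` with the untwisted `φ̃_i` (`untwist_conn`).
A value of `φ̃_{i,k}(g)` is block diagonal with blocks the values of `g` at the ends of paths, so its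
oscillation over `[0,1]` is bounded by that of `g` along contracting paths and tends to zero. While
`φ̃_{k,m}` evaluates a function at various points, `ψ_{k,m}` repeats its value at `0`; both agree up
to the oscillation. So the samples `ψ_{k,∞}(φ̃_{i,k}(f̃)(0))` form a Cauchy sequence, whose limit is
reached up to the oscillation at stage `k` (`norm_sampleLimit_sub_sample_le`). The norm of a function
of small oscillation is nearly its norm at `0`, so the limit morphism is isometric on `B`. The GNS
representation is isometric on each `M_{n_i}`, therefore on `M`.

The commutator. For Lipschitz `f` the function `f̃` is Lipschitz as well, and the oscillation of
`φ̃_{i,r(n)}(f̃)` is `O(4⁻ⁿ)`: the operator `a` of `f` is at distance `O(4⁻ⁿ)` from a matrix of stage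
`r(n)`, which commutes with `P_m` for `m ≥ n`. Such operators form a `⋆`-algebra (`HasRapidApprox`),
which therefore contains `𝒜`. If `k ≠ m` and `max k m = N + 1`, then the approximant of index `N`
commutes with `Q_{N+1}` and does not contribute to `Q_k a Q_m`, so this operator has norm `O(4⁻ᴺ)`,
while `|α_k - α_m| ≤ 2 b ^ N` for some `b < 4`. Therefore the series
`∑ (α_k - α_m) Q_k a Q_m` of the entries of `[D, a]` converges absolutely, and its sum is the bounded
extension of the commutator (`bounded_commutator_of_summable`).

Density of `𝒜` holds because a small multiple of any Lipschitz element of `B_i` lies in `LB_i`. If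
the unitaries and the paths are uniformly Lipschitz, then the images of a Lipschitz element in the
later stages have a common Lipschitz constant, which is eventually smaller than `γ ^ k`; so
`⋃ LB_i` consists of the images of all Lipschitz elements, and is a `⋆`-algebra.
-/

noncomputable section

/-! ### The diagonal operator of an exhausting sequence of finite-dimensional subspaces -/

section DiracOperator

open scoped InnerProductSpace

variable {H : Type} [NormedAddCommGroup H] [InnerProductSpace ℂ H]
variable (F : ℕ → Submodule ℂ H) [∀ n, FiniteDimensional ℂ (F n)]

theorem layerProj_mem (n : ℕ) (x : H) : layerProj F n x ∈ layer F n :=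
  (layer F n).starProjection_apply_mem x

theorem layerProj_of_mem {n : ℕ} {x : H} (hx : x ∈ layer F n) : layerProj F n x = x :=
  Submodule.starProjection_eq_self_iff.mpr hx

theorem norm_layerProj_le (n : ℕ) : ‖layerProj F n‖ ≤ 1 := (layer F n).starProjection_norm_le

theorem inner_layerProj_left (n : ℕ) (x y : H) :
    ⟪layerProj F n x, y⟫_ℂ = ⟪x, layerProj F n y⟫_ℂ :=
  (layer F n).inner_starProjection_left_eq_right x y

theorem layer_isOrtho_of_ne {F : ℕ → Submodule ℂ H} (hF : Monotone F) {m n : ℕ} (h : m ≠ n) :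
    layer F m ⟂ layer F n := by
  rcases lt_or_gt_of_ne h with h | h
  · exact layer_isOrtho F hF h
  · exact (layer_isOrtho F hF h).symm

variable {F}

theorem layerProj_of_mem_of_ne (hF : Monotone F) {m n : ℕ} (h : m ≠ n) {x : H}
    (hx : x ∈ layer F n) : layerProj F m x = 0 :=
  (Submodule.starProjection_apply_eq_zero_iff _).mpr
    ((Submodule.isOrtho_iff_le.mp (layer_isOrtho_of_ne hF h).symm) hx)

theorem layerProj_layerProj_self (n : ℕ) (x : H) :
    layerProj F n (layerProj F n x) = layerProj F n x :=
  layerProj_of_mem F (layerProj_mem F n x)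

theorem layerProj_layerProj_of_ne (hF : Monotone F) {m n : ℕ} (h : m ≠ n) (x : H) :
    layerProj F m (layerProj F n x) = 0 :=
  layerProj_of_mem_of_ne hF h (layerProj_mem F n x)

/-- The increments `Q_{n+1} = P_{n+1} - P_n` of the projections `P_n` onto `F n`. -/
theorem layerProj_succ (hF : Monotone F) (n : ℕ) (x : H) :
    layerProj F (n + 1) x = (F (n + 1)).starProjection x - (F n).starProjection x := by
  refine Submodule.eq_starProjection_of_mem_of_inner_eq_zero (K := layer F (n + 1)) ?_ ?_
  · refine ⟨sub_mem (Submodule.starProjection_apply_mem _ _)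
      (hF n.le_succ (Submodule.starProjection_apply_mem _ _)),
      (Submodule.mem_orthogonal' _ _).mpr fun w hw => ?_⟩
    have h1 := (F (n + 1)).starProjection_inner_eq_zero x w (hF n.le_succ hw)
    have h2 := (F n).starProjection_inner_eq_zero x w hw
    rw [inner_sub_left, sub_eq_zero] at h1 h2 ⊢
    rw [← h1, ← h2]
  · rintro w ⟨hw1, hw2⟩
    have h1 := (F (n + 1)).starProjection_inner_eq_zero x w hw1
    have h2 := (Submodule.mem_orthogonal _ _).mp hw2 _ ((F n).starProjection_apply_mem x)
    rw [sub_sub_eq_add_sub, add_sub_right_comm, inner_add_left, h1, h2, add_zero]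

theorem sum_range_layerProj (hF : Monotone F) (n : ℕ) (x : H) :
    ∑ k ∈ Finset.range (n + 1), layerProj F k x = (F n).starProjection x := by
  induction n with
  | zero => rw [Finset.sum_range_one]; rfl
  | succ n ih => rw [Finset.sum_range_succ, ih, layerProj_succ hF]; abel

theorem finrank_layer_succ (hF : Monotone F) (n : ℕ) :
    Module.finrank ℂ (layer F (n + 1)) + Module.finrank ℂ (F n) = Module.finrank ℂ (F (n + 1)) := by
  rw [add_comm, ← Submodule.finrank_add_inf_finrank_orthogonal (hF n.le_succ), layer, inf_comm]

theorem hasSum_layerProj_smul_layerProj (hF : Monotone F) (c : ℕ → ℂ) (n : ℕ) (x : H) :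
    HasSum (fun m => layerProj F n (c m • layerProj F m x)) (c n • layerProj F n x) := by
  have h := hasSum_single (f := fun m => layerProj F n (c m • layerProj F m x)) n fun m hm => by
    rw [map_smul, layerProj_layerProj_of_ne hF hm.symm, smul_zero]
  rwa [map_smul, layerProj_layerProj_self] at h

/-- Pythagoras for a finite sum of multiples of the `Q_n`. -/
theorem norm_sq_sum_smul_layerProj (hF : Monotone F) (c : ℕ → ℂ) (s : Finset ℕ) (x : H) :
    ‖∑ n ∈ s, c n • layerProj F n x‖ ^ 2 = ∑ n ∈ s, ‖c n • layerProj F n x‖ ^ 2 :=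
  (layer_orthogonalFamily F hF).norm_sum
    (fun n => c n • (layer F n).orthogonalProjectionOnto x) s

/-- Bessel's inequality for the `Q_n`. -/
theorem sum_norm_sq_layerProj_le (hF : Monotone F) (s : Finset ℕ) (x : H) :
    ∑ n ∈ s, ‖layerProj F n x‖ ^ 2 ≤ ‖x‖ ^ 2 := by
  obtain ⟨N, hN⟩ := s.exists_nat_subset_range
  have h := norm_sq_sum_smul_layerProj hF (fun _ => 1) (Finset.range (N + 1)) x
  simp only [one_smul] at h
  rw [sum_range_layerProj hF] at h
  calc ∑ n ∈ s, ‖layerProj F n x‖ ^ 2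
      ≤ ∑ n ∈ Finset.range (N + 1), ‖layerProj F n x‖ ^ 2 :=
        Finset.sum_le_sum_of_subset_of_nonneg
          (hN.trans (Finset.range_mono N.le_succ)) fun _ _ _ => by positivity
    _ = ‖(F N).starProjection x‖ ^ 2 := h.symm
    _ ≤ ‖x‖ ^ 2 := by
      gcongr
      exact (F N).norm_starProjection_apply_le x

theorem summable_norm_sq_layerProj (hF : Monotone F) (x : H) :
    Summable fun n => ‖layerProj F n x‖ ^ 2 :=
  summable_of_sum_le (fun _ => by positivity) fun s => sum_norm_sq_layerProj_le hF s x

theorem norm_sum_smul_layerProj_le (hF : Monotone F) (c : ℕ → ℂ) (s : Finset ℕ) {M : ℝ}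
    (hM : 0 ≤ M) (hc : ∀ n ∈ s, ‖c n‖ ≤ M) : ‖∑ n ∈ s, c n • layerProj F n‖ ≤ M := by
  refine ContinuousLinearMap.opNorm_le_bound _ hM fun x => ?_
  rw [← sq_le_sq₀ (norm_nonneg _) (by positivity), sum_apply]
  simp only [smul_apply]
  rw [norm_sq_sum_smul_layerProj hF c s x]
  calc ∑ n ∈ s, ‖c n • layerProj F n x‖ ^ 2
      ≤ ∑ n ∈ s, M ^ 2 * ‖layerProj F n x‖ ^ 2 := by
        refine Finset.sum_le_sum fun n hn => ?_
        rw [norm_smul, mul_pow]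
        gcongr
        exact hc n hn
    _ ≤ (M * ‖x‖) ^ 2 := by
        rw [← Finset.mul_sum, mul_pow]
        gcongr
        exact sum_norm_sq_layerProj_le hF s x

theorem isCompactOperator_layerProj (n : ℕ) : IsCompactOperator (layerProj F n) := by
  have h : IsCompactOperator ((layer F n).subtypeL) :=
    ((isCompactOperator_id_iff_finiteDimensional (𝕜 := ℂ)).mpr inferInstance).clm_comp _
  exact h.comp_clm ((layer F n).orthogonalProjectionOnto)

variable [CompleteSpace H]

theorem hasSum_layerProj (hF : Monotone F) (hd : ⊤ ≤ (⨆ n, F n).topologicalClosure) (x : H) :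
    HasSum (fun n => layerProj F n x) x := by
  have hs : Summable fun n => layerProj F n x := by
    have := summable_layerProj F hF (fun _ => 1) (v := x)
      (by simpa using summable_norm_sq_layerProj hF x)
    simpa using this
  have h1 := (tendsto_add_atTop_iff_nat 1).mpr hs.hasSum.tendsto_sum_nat
  simp only [sum_range_layerProj hF] at h1
  have h2 := tendsto_nhds_unique h1 (Submodule.starProjection_tendsto_self F hF x hd)
  simpa only [h2] using hs.hasSum

/-- The `Q_n` separate the points of `H`. -/
theorem eq_of_forall_layerProj_eq (hF : Monotone F) (hd : ⊤ ≤ (⨆ n, F n).topologicalClosure)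
    {v w : H} (h : ∀ n, layerProj F n v = layerProj F n w) : v = w := by
  have h1 := hasSum_layerProj hF hd v
  simp only [h] at h1
  exact h1.unique (hasSum_layerProj hF hd w)

theorem layerProj_diracOp (hF : Monotone F) (α : ℕ → ℝ) (x : (diracOp F hF α).domain) (n : ℕ) :
    layerProj F n (diracOp F hF α x) = (α n : ℂ) • layerProj F n (x : H) := by
  have h := (summable_layerProj F hF α x.2).hasSum.mapL (layerProj F n)
  exact h.unique (hasSum_layerProj_smul_layerProj hF (fun m => (α m : ℂ)) n x)

/-- A vector `v` lies in the domain of `D` and `D v = w` as soon as this holds in every layer. -/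
theorem diracOp_of_layerProj (hF : Monotone F) (hd : ⊤ ≤ (⨆ n, F n).topologicalClosure)
    (α : ℕ → ℝ) {v w : H} (h : ∀ n, layerProj F n w = (α n : ℂ) • layerProj F n v) :
    ∃ hv : v ∈ (diracOp F hF α).domain, diracOp F hF α ⟨v, hv⟩ = w := by
  have hv : v ∈ (diracOp F hF α).domain := by
    change Summable fun n => ‖(α n : ℂ) • layerProj F n v‖ ^ 2
    simpa only [← h] using summable_norm_sq_layerProj hF w
  exact ⟨hv, eq_of_forall_layerProj_eq hF hd fun n => by rw [layerProj_diracOp, h]⟩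

theorem diracOp_of_mem_layer (hF : Monotone F) (hd : ⊤ ≤ (⨆ n, F n).topologicalClosure)
    (α : ℕ → ℝ) {n : ℕ} {v : H} (hv : v ∈ layer F n) :
    ∃ h : v ∈ (diracOp F hF α).domain, diracOp F hF α ⟨v, h⟩ = (α n : ℂ) • v := by
  refine diracOp_of_layerProj hF hd α fun m => ?_
  rw [map_smul]
  rcases eq_or_ne m n with rfl | h
  · rfl
  · rw [layerProj_of_mem_of_ne hF h hv, smul_zero, smul_zero]

theorem dense_diracOp_domain (hF : Monotone F) (hd : ⊤ ≤ (⨆ n, F n).topologicalClosure)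
    (α : ℕ → ℝ) : Dense ((diracOp F hF α).domain : Set H) := fun x =>
  mem_closure_of_tendsto (hasSum_layerProj hF hd x) <| Eventually.of_forall fun _ =>
    sum_mem fun n _ => (diracOp_of_mem_layer hF hd α (layerProj_mem F n x)).1

theorem diracOp_isFormalAdjoint (hF : Monotone F) (hd : ⊤ ≤ (⨆ n, F n).topologicalClosure)
    (α : ℕ → ℝ) : (diracOp F hF α).IsFormalAdjoint (diracOp F hF α) := by
  intro x y
  have h1 := (hasSum_layerProj hF hd (diracOp F hF α x)).mapL (innerSL ℂ (y : H))
  have h2 := (hasSum_layerProj hF hd (x : H)).mapL (innerSL ℂ (diracOp F hF α y))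
  have h3 : ∀ n, innerSL ℂ (y : H) (layerProj F n (diracOp F hF α x)) =
      innerSL ℂ (diracOp F hF α y) (layerProj F n x) := fun n => by
    rw [layerProj_diracOp, innerSL_apply_apply, innerSL_apply_apply, inner_smul_right,
      ← layerProj_layerProj_self n (x : H), ← inner_layerProj_left,
      ← inner_layerProj_left F n (diracOp F hF α y : H), layerProj_diracOp, inner_smul_left,
      Complex.conj_ofReal]
  simp only [h3] at h1
  have h4 : ⟪(y : H), diracOp F hF α x⟫_ℂ = ⟪diracOp F hF α y, (x : H)⟫_ℂ := h1.unique h2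
  rw [← inner_conj_symm, h4, inner_conj_symm]

theorem diracOp_isSelfAdjoint (hF : Monotone F) (hd : ⊤ ≤ (⨆ n, F n).topologicalClosure)
    (α : ℕ → ℝ) : IsSelfAdjoint (diracOp F hF α) := by
  have hdense := dense_diracOp_domain hF hd α
  rw [LinearPMap.isSelfAdjoint_def]
  refine le_antisymm ?_ ((diracOp_isFormalAdjoint hF hd α).le_adjoint hdense)
  -- Testing against vectors of one layer shows that the adjoint acts as `α n` on the `n`-th layer.
  have key : ∀ y : (diracOp F hF α).adjoint.domain, ∃ hv : (y : H) ∈ (diracOp F hF α).domain,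
      diracOp F hF α ⟨y, hv⟩ = (diracOp F hF α).adjoint y := fun y => by
    refine diracOp_of_layerProj hF hd α fun n => ext_inner_right ℂ fun z => ?_
    obtain ⟨h1, h2⟩ := diracOp_of_mem_layer hF hd α (layerProj_mem F n z)
    have h3 := LinearPMap.adjoint_isFormalAdjoint hdense y ⟨_, h1⟩
    rw [h2, inner_smul_right] at h3
    rw [inner_layerProj_left, h3, inner_smul_left, inner_layerProj_left, Complex.conj_ofReal]
  refine ⟨fun y hy => (key ⟨y, hy⟩).1, fun y z hyz => ?_⟩
  obtain ⟨h1, h2⟩ := key y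
  rw [← h2]
  congr 1
  exact Subtype.ext hyz

/-! ### Compact resolvent -/

/-- A diagonal operator with coefficients tending to zero is a norm-convergent series. -/
theorem summable_smul_layerProj (hF : Monotone F) {c : ℕ → ℂ} (hc : Tendsto c atTop (𝓝 0)) :
    Summable fun n => c n • layerProj F n := by
  rw [summable_iff_vanishing_norm]
  intro ε hε
  obtain ⟨N, hN⟩ := (Metric.tendsto_atTop.mp hc) (ε / 2) (half_pos hε)
  refine ⟨Finset.range N, fun t ht => ?_⟩
  refine (norm_sum_smul_layerProj_le hF c t (half_pos hε).le fun n hn => ?_).trans_lt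
    (half_lt_self hε)
  have h : N ≤ n := by
    by_contra! h
    exact Finset.disjoint_left.mp ht hn (Finset.mem_range.mpr h)
  simpa using (hN n h).le

theorem diracOp_hasCompactResolvent (hF : Monotone F)
    (hd : ⊤ ≤ (⨆ n, F n).topologicalClosure) {α : ℕ → ℝ}
    (hα : Tendsto (fun n => |α n|) atTop atTop) : HasCompactResolvent (diracOp F hF α) := by
  intro z hz
  have hne : ∀ n, (α n : ℂ) - z ≠ 0 := fun n h => hz (by
    have := congrArg Complex.im h
    simpa using this)
  have hc : Tendsto (fun n => ((α n : ℂ) - z)⁻¹) atTop (𝓝 0) := by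
    refine tendsto_inv₀_cobounded.comp ?_
    rw [← tendsto_norm_atTop_iff_cobounded]
    refine tendsto_atTop_mono (fun n => ?_) (tendsto_atTop_add_const_right _ (-‖z‖) hα)
    have := norm_sub_norm_le (α n : ℂ) z
    rw [Complex.norm_real, Real.norm_eq_abs] at this
    linarith
  have hs := summable_smul_layerProj hF hc
  set R : H →L[ℂ] H := ∑' n, ((α n : ℂ) - z)⁻¹ • layerProj F n with hR
  have hQR : ∀ n v, layerProj F n (R v) = ((α n : ℂ) - z)⁻¹ • layerProj F n v := by
    intro n v
    have h1 := (hs.hasSum.mapL (ContinuousLinearMap.apply ℂ H v)).mapL (layerProj F n)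
    exact h1.unique (hasSum_layerProj_smul_layerProj hF (fun m => ((α m : ℂ) - z)⁻¹) n v)
  refine ⟨R, ?_, fun v => ?_, fun x => ?_⟩
  · refine isClosed_setOfPred_isCompactOperator.mem_of_tendsto hs.hasSum
      (Eventually.of_forall fun s => ?_)
    induction s using Finset.induction_on with
    | empty => simpa using (isCompactOperator_zero : IsCompactOperator (0 : H → H))
    | insert n s hn ih =>
      rw [Finset.sum_insert hn]
      exact ((isCompactOperator_layerProj n).smul _).add ih
  · obtain ⟨h1, h2⟩ := diracOp_of_layerProj hF hd α (v := R v) (w := v + z • R v) fun n => by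
      rw [map_add, map_smul, hQR, smul_smul, smul_smul]
      nth_rw 1 [← one_smul ℂ (layerProj F n v)]
      rw [← add_smul]
      congr 1
      have := hne n
      field_simp
      ring
    exact ⟨h1, by rw [h2, add_sub_cancel_right]⟩
  · refine eq_of_forall_layerProj_eq hF hd fun n => ?_
    rw [hQR, map_sub, map_smul, layerProj_diracOp, ← sub_smul, smul_smul, inv_mul_cancel₀ (hne n),
      one_smul]

/-! ### Summability -/

/-- Orthonormal bases of the layers form an orthonormal basis of eigenvectors of `D`. -/
theorem diracOp_isPSummable (hF : Monotone F) (hd : ⊤ ≤ (⨆ n, F n).topologicalClosure)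
    (α : ℕ → ℝ) (p : ℝ) (hs : Summable fun n =>
      (1 + α (n + 1) ^ 2) ^ (-p / 2) * (Module.finrank ℂ (layer F (n + 1)) : ℝ)) :
    IsPSummable (diracOp F hF α) p := by
  let e : ∀ n, OrthonormalBasis (Fin (Module.finrank ℂ (layer F n))) ℂ (layer F n) :=
    fun n => stdOrthonormalBasis ℂ (layer F n)
  let v : (Σ n, Fin (Module.finrank ℂ (layer F n))) → H := fun k => (e k.1 k.2 : H)
  have hv : Orthonormal ℂ v :=
    (layer_orthogonalFamily F hF).orthonormal_sigma_orthonormal fun n => (e n).orthonormal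
  have hsp : (Submodule.span ℂ (Set.range v))ᗮ = ⊥ := by
    rw [Submodule.eq_bot_iff]
    intro x hx
    refine eq_of_forall_layerProj_eq hF hd fun n => ?_
    rw [map_zero]
    refine (Submodule.starProjection_apply_eq_zero_iff _).mpr ?_
    rw [Submodule.mem_orthogonal]
    intro y hy
    have h1 := (e n).sum_repr ⟨y, hy⟩
    have h2 : y = ∑ i, (e n).repr ⟨y, hy⟩ i • v ⟨n, i⟩ := by
      conv_lhs => rw [show y = ((⟨y, hy⟩ : layer F n) : H) from rfl, ← h1]
      simp [v]
    refine (Submodule.mem_orthogonal _ _).mp hx y ?_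
    rw [h2]
    exact sum_mem fun i _ => Submodule.smul_mem _ _ (Submodule.subset_span ⟨_, rfl⟩)
  refine ⟨_, HilbertBasis.mkOfOrthogonalEqBot hv hsp, fun k => α k.1, fun k => ?_, ?_⟩
  · rw [HilbertBasis.coe_mkOfOrthogonalEqBot]
    exact diracOp_of_mem_layer hF hd α (e k.1 k.2).2
  · refine (summable_sigma_of_nonneg fun k => by positivity).mpr
      ⟨fun n => Summable.of_finite, ?_⟩
    rw [← summable_nat_add_iff 1]
    refine hs.congr fun n => ?_
    simp [mul_comm]

end DiracOperator

/-! ### Operators with bounded commutator -/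

section Commutator

variable {H : Type} [NormedAddCommGroup H] [InnerProductSpace ℂ H]
variable {F : ℕ → Submodule ℂ H} [∀ n, FiniteDimensional ℂ (F n)]

theorem commute_layerProj_succ (hF : Monotone F) {a : H →L[ℂ] H} {n : ℕ}
    (h1 : Commute a (F n).starProjection) (h2 : Commute a (F (n + 1)).starProjection) :
    Commute a (layerProj F (n + 1)) := by
  have h : layerProj F (n + 1) = (F (n + 1)).starProjection - (F n).starProjection := by
    ext x
    exact layerProj_succ hF n x
  rw [h]
  exact h2.sub_right h1

theorem layerProj_mul_layerProj_of_ne (hF : Monotone F) {m n : ℕ} (h : m ≠ n) :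
    layerProj F m * layerProj F n = 0 := by
  ext x
  exact layerProj_layerProj_of_ne hF h x

/-- A matrix entry of `a` off the diagonal is controlled by the distance of `a` from an operator
commuting with one of the two projections. -/
theorem norm_layerProj_mul_mul_layerProj_le (hF : Monotone F) {m n : ℕ} (hmn : m ≠ n)
    (a : H →L[ℂ] H) {b : H →L[ℂ] H}
    (hb : Commute b (layerProj F m) ∨ Commute b (layerProj F n)) :
    ‖layerProj F m * a * layerProj F n‖ ≤ ‖a - b‖ := by
  have h0 : layerProj F m * b * layerProj F n = 0 := by
    rcases hb with hb | hb
    · rw [← hb.eq, mul_assoc, layerProj_mul_layerProj_of_ne hF hmn, mul_zero]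
    · rw [mul_assoc, hb.eq, ← mul_assoc, layerProj_mul_layerProj_of_ne hF hmn, zero_mul]
  have h1 : layerProj F m * a * layerProj F n = layerProj F m * (a - b) * layerProj F n := by
    rw [mul_sub, sub_mul, h0, sub_zero]
  rw [h1]
  calc ‖layerProj F m * (a - b) * layerProj F n‖
      ≤ ‖layerProj F m‖ * ‖a - b‖ * ‖layerProj F n‖ := norm_mul₃_le
    _ ≤ 1 * ‖a - b‖ * 1 := by
      gcongr
      exacts [norm_layerProj_le F m, norm_layerProj_le F n]
    _ = ‖a - b‖ := by ring

/-- The operators `a` at distance `O(4⁻ⁿ)` from operators which, for every `m ≥ n`, commute with the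
projection onto `F m`. -/
def HasRapidApprox (F : ℕ → Submodule ℂ H) [∀ n, FiniteDimensional ℂ (F n)] (a : H →L[ℂ] H) :
    Prop :=
  ∃ (K : ℝ) (b : ℕ → H →L[ℂ] H), (∀ n m, n ≤ m → Commute (b n) (F m).starProjection) ∧
    ∀ n, ‖a - b n‖ ≤ K / 4 ^ n

namespace HasRapidApprox

theorem nonneg_const {a b : H →L[ℂ] H} {K : ℝ} {n : ℕ} (h : ‖a - b‖ ≤ K / 4 ^ n) : 0 ≤ K := by
  have h1 := (norm_nonneg _).trans h
  have h2 : (0 : ℝ) < 4 ^ n := by positivity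
  simpa [h2.ne'] using mul_nonneg h1 h2.le

theorem of_algebraMap (c : ℂ) : HasRapidApprox F (algebraMap ℂ (H →L[ℂ] H) c) :=
  ⟨0, fun _ => algebraMap ℂ _ c, fun _ _ _ => Algebra.commutes c _, fun n => by simp⟩

theorem add {a a' : H →L[ℂ] H} (h : HasRapidApprox F a) (h' : HasRapidApprox F a') :
    HasRapidApprox F (a + a') := by
  obtain ⟨K, b, hb, hK⟩ := h
  obtain ⟨K', b', hb', hK'⟩ := h'
  refine ⟨K + K', fun n => b n + b' n, fun n m hnm => (hb n m hnm).add_left (hb' n m hnm),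
    fun n => ?_⟩
  rw [add_sub_add_comm, add_div]
  exact (norm_add_le _ _).trans (add_le_add (hK n) (hK' n))

theorem mul {a a' : H →L[ℂ] H} (h : HasRapidApprox F a) (h' : HasRapidApprox F a') :
    HasRapidApprox F (a * a') := by
  obtain ⟨K, b, hb, hK⟩ := h
  obtain ⟨K', b', hb', hK'⟩ := h'
  have hK0 := nonneg_const (hK 0)
  refine ⟨K * ‖a'‖ + (‖a‖ + K) * K', fun n => b n * b' n,
    fun n m hnm => (hb n m hnm).mul_left (hb' n m hnm), fun n => ?_⟩
  have h1 : a * a' - b n * b' n = (a - b n) * a' + b n * (a' - b' n) := by noncomm_ring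
  have h2 : ‖b n‖ ≤ ‖a‖ + K := by
    have h3 : K / 4 ^ n ≤ K := div_le_self hK0 (one_le_pow₀ (by norm_num))
    have h4 := norm_sub_norm_le (b n) a
    rw [norm_sub_rev] at h4
    linarith [hK n]
  rw [h1]
  calc ‖(a - b n) * a' + b n * (a' - b' n)‖
      ≤ ‖a - b n‖ * ‖a'‖ + ‖b n‖ * ‖a' - b' n‖ :=
        (norm_add_le _ _).trans (add_le_add (norm_mul_le _ _) (norm_mul_le _ _))
    _ ≤ K / 4 ^ n * ‖a'‖ + (‖a‖ + K) * (K' / 4 ^ n) := by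
        gcongr
        exacts [hK n, hK' n]
    _ = (K * ‖a'‖ + (‖a‖ + K) * K') / 4 ^ n := by ring

/-- It suffices to have the approximants from some index on. -/
theorem of_eventually {a : H →L[ℂ] H} {K : ℝ} (b : ℕ → H →L[ℂ] H) (j : ℕ)
    (hb : ∀ n m, n ≤ m → Commute (b n) (F m).starProjection)
    (hK : ∀ n, j ≤ n → ‖a - b n‖ ≤ K / 4 ^ n) : HasRapidApprox F a := by
  refine ⟨max K (‖a‖ * 4 ^ j), fun n => if j ≤ n then b n else 0, fun n m hnm => ?_, fun n => ?_⟩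
  · dsimp only
    split_ifs
    exacts [hb n m hnm, Commute.zero_left _]
  · dsimp only
    split_ifs with h
    · exact (hK n h).trans (by gcongr; exact le_max_left _ _)
    · rw [sub_zero, le_div_iff₀ (by positivity)]
      refine le_trans ?_ (le_max_right _ _)
      gcongr
      exacts [by norm_num, (not_le.mp h).le]

variable [CompleteSpace H]

theorem star {a : H →L[ℂ] H} (h : HasRapidApprox F a) : HasRapidApprox F (star a) := by
  obtain ⟨K, b, hb, hK⟩ := h
  refine ⟨K, fun n => Star.star (b n), fun n m hnm => ?_, fun n => ?_⟩
  · have h := (hb n m hnm).star_star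
    rwa [(isSelfAdjoint_starProjection (F m)).star_eq] at h
  · rw [← star_sub, norm_star]
    exact hK n

end HasRapidApprox

/-- A double series whose terms decay geometrically in `max k m` converges. -/
theorem summable_of_le_pow_max {f : ℕ × ℕ → ℝ} {C ρ : ℝ} (hf : ∀ p, 0 ≤ f p) (hC : 0 ≤ C)
    (hρ₀ : 0 ≤ ρ) (hρ₁ : ρ < 1) (h : ∀ p, f p ≤ C * ρ ^ max p.1 p.2) : Summable f := by
  have hσ1 : √ρ < 1 := by rw [Real.sqrt_lt' one_pos]; simpa using hρ₁
  have hg := summable_geometric_of_lt_one (Real.sqrt_nonneg ρ) hσ1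
  have hs := (hg.mul_of_nonneg hg (fun n => by positivity) (fun n => by positivity)).mul_left C
  refine Summable.of_nonneg_of_le hf (fun p => (h p).trans ?_) hs
  gcongr
  calc ρ ^ max p.1 p.2 = √ρ ^ (2 * max p.1 p.2) := by rw [pow_mul, Real.sq_sqrt hρ₀]
    _ ≤ √ρ ^ (p.1 + p.2) := pow_le_pow_of_le_one (Real.sqrt_nonneg ρ) hσ1.le (by omega)
    _ = √ρ ^ p.1 * √ρ ^ p.2 := pow_add _ _ _

variable [CompleteSpace H]

/-- If the matrix entries `(α k - α m) Q_k a Q_m` of the commutator `[D, a]` are absolutely summable,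
then their sum is the bounded operator extending `[D, a]`. -/
theorem bounded_commutator_of_summable (hF : Monotone F)
    (hd : ⊤ ≤ (⨆ n, F n).topologicalClosure) (α : ℕ → ℝ) {a : H →L[ℂ] H}
    (hs : Summable fun p : ℕ × ℕ =>
      ((α p.1 : ℂ) - α p.2) • (layerProj F p.1 * a * layerProj F p.2)) :
    ∃ T : H →L[ℂ] H, ∀ x : (diracOp F hF α).domain, ∃ h : a x ∈ (diracOp F hF α).domain,
      diracOp F hF α ⟨a x, h⟩ = a (diracOp F hF α x) + T x := by
  refine ⟨∑' p : ℕ × ℕ, ((α p.1 : ℂ) - α p.2) • (layerProj F p.1 * a * layerProj F p.2),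
    fun x => diracOp_of_layerProj hF hd α fun k => ?_⟩
  -- The `k`-th component of `T x` is the sum of the entries of the `k`-th row.
  have h1 := (hs.hasSum.mapL (ContinuousLinearMap.apply ℂ H (x : H))).mapL (layerProj F k)
  have h2 : HasSum (fun m => ((α k : ℂ) - α m) • layerProj F k (a (layerProj F m (x : H))))
      (layerProj F k ((∑' p : ℕ × ℕ, ((α p.1 : ℂ) - α p.2) •
        (layerProj F p.1 * a * layerProj F p.2)) (x : H))) := by
    refine (((Prod.mk_right_injective k).hasSum_iff fun p hp => ?_).mpr h1).congr_fun fun m => ?_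
    · have hpk : k ≠ p.1 := fun h => hp ⟨p.2, by rw [h]⟩
      change layerProj F k (((α p.1 : ℂ) - α p.2) • layerProj F p.1 _) = 0
      rw [map_smul, layerProj_layerProj_of_ne hF hpk, smul_zero]
    · change _ = layerProj F k (((α k : ℂ) - α m) • layerProj F k _)
      rw [map_smul, layerProj_layerProj_self]
      rfl
  have h3 := (((hasSum_layerProj hF hd (x : H)).mapL a).mapL (layerProj F k)).const_smul (α k : ℂ)
  have h4 := ((hasSum_layerProj hF hd (diracOp F hF α x)).mapL a).mapL (layerProj F k)
  have h5 := h2.unique ((h3.sub h4).congr_fun fun m => by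
    rw [layerProj_diracOp, map_smul, map_smul, sub_smul])
  rw [map_add, h5, add_sub_cancel]

/-- If `a` is approximated at rate `4⁻ⁿ` and `|α (n + 1)| ≤ bⁿ` with `b < 4`, then `a` preserves the
domain of `D` and `[D, a]` is bounded: the entry `(α k - α m) Q_k a Q_m` is of order
`(b / 4) ^ max k m`. -/
theorem HasRapidApprox.bounded_commutator (hF : Monotone F)
    (hd : ⊤ ≤ (⨆ n, F n).topologicalClosure) {α : ℕ → ℝ} {b : ℝ} (hb₁ : 1 ≤ b) (hb₄ : b < 4)
    (hα₀ : α 0 = 0) (hα : ∀ n, |α (n + 1)| ≤ b ^ n) {a : H →L[ℂ] H} (ha : HasRapidApprox F a) :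
    ∃ T : H →L[ℂ] H, ∀ x : (diracOp F hF α).domain, ∃ h : a x ∈ (diracOp F hF α).domain,
      diracOp F hF α ⟨a x, h⟩ = a (diracOp F hF α x) + T x := by
  obtain ⟨K, A, hA, hK⟩ := ha
  have hK0 := nonneg_const (hK 0)
  have hb0 : 0 < b := by linarith
  refine bounded_commutator_of_summable hF hd α (Summable.of_norm ?_)
  refine summable_of_le_pow_max (C := 2 * K * (4 / b)) (ρ := b / 4) (fun _ => norm_nonneg _)
    (by positivity) (by positivity) (by linarith) ?_
  rintro ⟨k, m⟩
  dsimp only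
  rcases eq_or_ne k m with rfl | hkm
  · rw [sub_self, zero_smul, norm_zero]
    positivity
  obtain ⟨M, hM⟩ : ∃ M, max k m = M + 1 := Nat.exists_eq_succ_of_ne_zero (by omega)
  have hcomm : Commute (A M) (layerProj F (M + 1)) :=
    commute_layerProj_succ hF (hA M M le_rfl) (hA M (M + 1) M.le_succ)
  have h1 : ‖layerProj F k * a * layerProj F m‖ ≤ K / 4 ^ M := by
    refine (norm_layerProj_mul_mul_layerProj_le hF hkm a ?_).trans (hK M)
    rcases max_choice k m with h | h
    · left; rwa [← h, hM]
    · right; rwa [← h, hM]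
  have hα' : ∀ i, i ≤ M + 1 → |α i| ≤ b ^ M := fun i hi => by
    cases i with
    | zero => rw [hα₀, abs_zero]; positivity
    | succ i => exact (hα i).trans (pow_le_pow_right₀ hb₁ (by omega))
  have h2 : ‖(α k : ℂ) - α m‖ ≤ 2 * b ^ M := by
    rw [← Complex.ofReal_sub, Complex.norm_real, Real.norm_eq_abs]
    have := abs_sub (α k) (α m)
    have := hα' k (by omega)
    have := hα' m (by omega)
    linarith
  rw [norm_smul, hM]
  calc ‖(α k : ℂ) - α m‖ * ‖layerProj F k * a * layerProj F m‖
      ≤ (2 * b ^ M) * (K / 4 ^ M) := by gcongr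
    _ = 2 * K * (4 / b) * (b / 4) ^ (M + 1) := by
      rw [pow_succ, div_pow]
      field_simp

/-- An operator which, like its adjoint, leaves a subspace invariant commutes with the
projection onto it. -/
theorem commute_starProjection {U : Submodule ℂ H} [U.HasOrthogonalProjection] {a : H →L[ℂ] H}
    (h : ∀ x ∈ U, a x ∈ U) (h' : ∀ x ∈ U, star a x ∈ U) : Commute a U.starProjection := by
  ext x
  refine (Submodule.eq_starProjection_of_mem_of_inner_eq_zero (h _ (U.starProjection_apply_mem x))
    fun w hw => ?_).symm
  change inner ℂ (a x - a (U.starProjection x)) w = 0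
  rw [← map_sub, ← ContinuousLinearMap.adjoint_inner_right]
  exact U.starProjection_inner_eq_zero x _ (h' w hw)

end Commutator

/-! ### Maps out of an inductive limit -/

section LimitMaps

variable {X : ℕ → Type} [∀ i, CStarAlgebra (X i)] (φ : ∀ i, X i →⋆ₐ[ℂ] X (i + 1))

theorem CStarLimit.of_seqMap (i j : ℕ) (h : i ≤ j) (x : X i) :
    CStarLimit.of φ j (seqMap φ i j h x) = CStarLimit.of φ i x :=
  congrArg (CStarLimit.coe φ) (AlgLimit.of_seqMap φ i j h x)

theorem CStarLimit.norm_of_le (i : ℕ) (x : X i) : ‖CStarLimit.of φ i x‖ ≤ ‖x‖ :=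
  NonUnitalStarAlgHom.norm_apply_le _ x

theorem CStarLimit.exists_of_eq_coe (z : AlgLimit φ) :
    ∃ i x, CStarLimit.of φ i x = CStarLimit.coe φ z := by
  obtain ⟨i, x, rfl⟩ := AlgLimit.exists_of φ z
  exact ⟨i, x, rfl⟩

/-- The images of the stages are dense in the inductive limit. -/
theorem CStarLimit.dense_iUnion_range :
    Dense (⋃ i, Set.range (CStarLimit.of φ i)) := by
  refine (CStarLimit.denseRange_coe φ).mono ?_
  rintro _ ⟨z, rfl⟩
  obtain ⟨i, x, h⟩ := CStarLimit.exists_of_eq_coe φ z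
  exact Set.mem_iUnion.mpr ⟨i, x, h⟩

/-- An element on which the norm survives in all later stages keeps its norm in the limit. -/
theorem CStarLimit.le_norm_of {i : ℕ} {x : X i} {c : ℝ}
    (h : ∀ k (hk : i ≤ k), c ≤ ‖seqMap φ i k hk x‖) : c ≤ ‖CStarLimit.of φ i x‖ := by
  change c ≤ ‖CStarLimit.coe φ (AlgLimit.of φ i x)‖
  rw [CStarLimit.norm_coe]
  refine le_csInf (AlgLimit.normSet_nonempty φ _) ?_
  rintro _ ⟨j, y, hy, rfl⟩
  obtain ⟨k, hj, hi, hk⟩ := (AlgLimit.of_eq_iff φ _ _ _ _).mp hy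
  exact (h k hi).trans (hk ▸ seqMap_norm_le φ j k hj y)

theorem seqMap_injective (hφ : ∀ i, Function.Injective (φ i)) (i j : ℕ) (h : i ≤ j) :
    Function.Injective (seqMap φ i j h) := by
  induction j, h using Nat.le_induction with
  | base => rw [seqMap_self]; exact Function.injective_id
  | succ j h ih => rw [seqMap_succ φ i j h]; exact (hφ j).comp ih

/-- If the connecting morphisms are injective, the stages embed isometrically. -/
theorem CStarLimit.norm_of (hφ : ∀ i, Function.Injective (φ i)) (i : ℕ) (x : X i) :
    ‖CStarLimit.of φ i x‖ = ‖x‖ :=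
  (CStarLimit.norm_of_le φ i x).antisymm <| CStarLimit.le_norm_of φ fun k hk =>
    (NonUnitalStarAlgHom.norm_map (seqMap φ i k hk) (seqMap_injective φ hφ i k hk) x).ge

variable {φ} {A : Type} [CStarAlgebra A]

/-- A compatible family of morphisms on the stages factors through the algebraic direct limit. -/
def AlgLimit.lift (θ : ∀ i, X i →⋆ₐ[ℂ] A) (hθ : ∀ i x, θ (i + 1) (φ i x) = θ i x) :
    AlgLimit φ →ₗ[ℂ] A where
  toFun z := DirectLimit.lift (seqMap φ) (fun i x => θ i x) (fun i j h x => by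
    induction j, h using Nat.le_induction with
    | base => rw [seqMap_self]; rfl
    | succ j h ih => rw [seqMap_succ φ i j h, StarAlgHom.comp_apply, hθ, ih]) z
  map_add' z w := by
    obtain ⟨i, x, y, rfl, rfl, -, -⟩ := AlgLimit.exists_lt₂ φ z w one_pos
    rw [← map_add]
    exact map_add (θ i) x y
  map_smul' c z := by
    obtain ⟨i, x, rfl⟩ := AlgLimit.exists_of φ z
    rw [← map_smul]
    exact map_smul (θ i) c x

theorem AlgLimit.lift_of (θ : ∀ i, X i →⋆ₐ[ℂ] A) (hθ : ∀ i x, θ (i + 1) (φ i x) = θ i x)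
    (i : ℕ) (x : X i) : AlgLimit.lift θ hθ (AlgLimit.of φ i x) = θ i x := rfl

theorem AlgLimit.norm_lift_le (θ : ∀ i, X i →⋆ₐ[ℂ] A) (hθ : ∀ i x, θ (i + 1) (φ i x) = θ i x)
    (z : AlgLimit φ) : ‖AlgLimit.lift θ hθ z‖ ≤ 1 * ‖z‖ := by
  rw [one_mul]
  refine le_csInf (AlgLimit.normSet_nonempty φ z) ?_
  rintro _ ⟨i, x, rfl, rfl⟩
  exact NonUnitalStarAlgHom.norm_apply_le (θ i) x

variable (φ) in
/-- The canonical map into the completion, as a continuous linear map. -/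
def CStarLimit.coeL : AlgLimit φ →L[ℂ] CStarLimit φ where
  toFun := CStarLimit.coe φ
  map_add' := CStarLimit.coe_add φ
  map_smul' := CStarLimit.coe_smul φ
  cont := CStarLimit.continuous_coe φ

/-- The continuous extension of `AlgLimit.lift` to the completion. -/
def CStarLimit.liftL (θ : ∀ i, X i →⋆ₐ[ℂ] A) (hθ : ∀ i x, θ (i + 1) (φ i x) = θ i x) :
    CStarLimit φ →L[ℂ] A :=
  ((AlgLimit.lift θ hθ).mkContinuous 1 (AlgLimit.norm_lift_le θ hθ)).extend (CStarLimit.coeL φ)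

theorem CStarLimit.liftL_coe (θ : ∀ i, X i →⋆ₐ[ℂ] A) (hθ : ∀ i x, θ (i + 1) (φ i x) = θ i x)
    (z : AlgLimit φ) : CStarLimit.liftL θ hθ (CStarLimit.coe φ z) = AlgLimit.lift θ hθ z :=
  ContinuousLinearMap.extend_eq _ (e := CStarLimit.coeL φ) (CStarLimit.denseRange_coe φ)
    (UniformSpace.Completion.isUniformInducing_coe _) z

theorem CStarLimit.liftL_of (θ : ∀ i, X i →⋆ₐ[ℂ] A) (hθ : ∀ i x, θ (i + 1) (φ i x) = θ i x)
    (i : ℕ) (x : X i) : CStarLimit.liftL θ hθ (CStarLimit.of φ i x) = θ i x :=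
  CStarLimit.liftL_coe θ hθ _

/-- The universal property of the C⋆-inductive limit. -/
def CStarLimit.lift (θ : ∀ i, X i →⋆ₐ[ℂ] A) (hθ : ∀ i x, θ (i + 1) (φ i x) = θ i x) :
    CStarLimit φ →⋆ₐ[ℂ] A where
  toFun := CStarLimit.liftL θ hθ
  map_one' := by rw [← map_one (CStarLimit.of φ 0), CStarLimit.liftL_of, map_one]
  map_mul' x y := by
    refine (CStarLimit.denseRange_coe φ).induction_on₂ (isClosed_eq (by fun_prop) (by fun_prop))
      (fun z w => ?_) x y
    obtain ⟨i, x, y, rfl, rfl, -, -⟩ := AlgLimit.exists_lt₂ φ z w one_pos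
    rw [← CStarLimit.coe_mul, ← map_mul, CStarLimit.liftL_coe, CStarLimit.liftL_coe,
      CStarLimit.liftL_coe]
    exact map_mul (θ i) x y
  map_zero' := map_zero _
  map_add' := map_add _
  commutes' c := by
    rw [← AlgHomClass.commutes (CStarLimit.of φ 0) c, CStarLimit.liftL_of, AlgHomClass.commutes]
  map_star' x := by
    have hs := CStarLimit.continuous_star' φ
    refine (CStarLimit.denseRange_coe φ).induction_on x (isClosed_eq (by fun_prop) (by fun_prop))
      fun z => ?_
    obtain ⟨i, x, rfl⟩ := AlgLimit.exists_of φ z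
    rw [CStarLimit.star_coe, ← map_star, CStarLimit.liftL_coe, CStarLimit.liftL_coe]
    exact map_star (θ i) x

theorem CStarLimit.lift_of (θ : ∀ i, X i →⋆ₐ[ℂ] A) (hθ : ∀ i x, θ (i + 1) (φ i x) = θ i x)
    (i : ℕ) (x : X i) : CStarLimit.lift θ hθ (CStarLimit.of φ i x) = θ i x :=
  CStarLimit.liftL_of θ hθ i x

/-- A morphism which does not decrease the norm on any stage is injective on the limit. -/
theorem CStarLimit.injective_of_norm_le (f : CStarLimit φ →⋆ₐ[ℂ] A)
    (h : ∀ i x, ‖CStarLimit.of φ i x‖ ≤ ‖f (CStarLimit.of φ i x)‖) : Function.Injective f := by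
  have hf : Continuous f :=
    AddMonoidHomClass.continuous_of_bound f 1 fun x => by
      simpa using NonUnitalStarAlgHom.norm_apply_le f x
  have key : ∀ x, ‖x‖ ≤ ‖f x‖ := fun x => by
    refine (CStarLimit.denseRange_coe φ).induction_on x (isClosed_le (by fun_prop) (by fun_prop))
      fun z => ?_
    obtain ⟨i, y, hy⟩ := CStarLimit.exists_of_eq_coe φ z
    rw [← hy]
    exact h i y
  refine (injective_iff_map_eq_zero f).mpr fun x hx => norm_le_zero_iff.mp ?_
  simpa [hx] using key x

end LimitMaps

/-! ### The GNS representation of the UHF algebra -/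

section UHF

variable (l : ℕ → ℕ+)

theorem ampl_injective (i : ℕ) : Function.Injective (ampl l i) := by
  intro a b h
  have h1 : (fun _ : Fin (l i) => a) = fun _ => b := by
    refine Matrix.blockDiagonal_injective ?_
    exact (Matrix.reindex (finProdFinEquiv.symm.trans (Equiv.prodComm _ _)).symm
      (finProdFinEquiv.symm.trans (Equiv.prodComm _ _)).symm).injective h
  exact congrFun h1 ⟨0, (l i).pos⟩

theorem norm_of_ampl (i : ℕ) (a : Mat (dim l i)) : ‖CStarLimit.of (ampl l) i a‖ = ‖a‖ :=
  CStarLimit.norm_of (ampl l) (ampl_injective l) i a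

open scoped ComplexOrder in
/-- The trace is faithful on matrices, so `M_{n_i}` embeds in the GNS space. -/
theorem gnsIncl_injective (i : ℕ) : Function.Injective (gnsIncl l i) := by
  refine (injective_iff_map_eq_zero (gnsIncl l i)).mpr fun a ha => ?_
  have h1 : ‖gnsIncl l i a‖ = ‖(uhfTrace l).toPreGNS (CStarLimit.of (ampl l) i a)‖ :=
    UniformSpace.Completion.norm_coe _
  have h2 := (uhfTrace l).preGNS_norm_sq ((uhfTrace l).toPreGNS (CStarLimit.of (ampl l) i a))
  rw [← h1, ha, PositiveLinearMap.ofPreGNS_toPreGNS, ← map_star, ← map_mul, uhfTrace_of] at h2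
  have h3 : ((dim l i : ℕ) : ℂ) ≠ 0 := by exact_mod_cast (dim_pos l i).ne'
  have h4 : (star a * a).trace = 0 := by
    simpa [h3] using h2.symm
  exact Matrix.trace_conjTranspose_mul_self_eq_zero_iff.mp h4

theorem finrank_gnsStage (i : ℕ) : Module.finrank ℂ (gnsStage l i) = dim l i ^ 2 := by
  rw [gnsStage, LinearMap.finrank_range_of_inj (gnsIncl_injective l i), Module.finrank_matrix]
  simp [sq]

theorem dense_iSup_gnsStage : (⨆ i, gnsStage l i).topologicalClosure = ⊤ := by
  rw [← Submodule.dense_iff_topologicalClosure_eq_top]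
  let j : UHF l → GNSSpace l := fun x => ((uhfTrace l).toPreGNS x : (uhfTrace l).PreGNS)
  have hj : Continuous j := by
    have h : ∀ x, j x = (uhfTrace l).gnsStarAlgHom x (j 1) := fun x => by
      have h1 : (uhfTrace l).gnsStarAlgHom x (j 1) = _ :=
        (uhfTrace l).gnsNonUnitalStarAlgHom_apply_coe
      rw [h1, PositiveLinearMap.leftMulMapPreGNS_apply, PositiveLinearMap.ofPreGNS_toPreGNS,
        mul_one]
    have h2 : Continuous (uhfTrace l).gnsStarAlgHom :=
      AddMonoidHomClass.continuous_of_bound _ 1 fun x => by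
        simpa using NonUnitalStarAlgHom.norm_apply_le (uhfTrace l).gnsStarAlgHom x
    exact (h2.clm_apply continuous_const).congr fun x => (h x).symm
  have hd : DenseRange j :=
    (UniformSpace.Completion.denseRange_coe (α := (uhfTrace l).PreGNS)).mono <| by
      rintro _ ⟨y, rfl⟩
      exact ⟨(uhfTrace l).ofPreGNS y, rfl⟩
  refine (hd.dense_image hj (CStarLimit.dense_iUnion_range (ampl l))).mono ?_
  rintro _ ⟨x, hx, rfl⟩
  obtain ⟨i, a, rfl⟩ := Set.mem_iUnion.mp hx
  exact Submodule.mem_iSup_of_mem i ⟨a, rfl⟩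

theorem gnsStarAlgHom_of_gnsIncl (i : ℕ) (a b : Mat (dim l i)) :
    (uhfTrace l).gnsStarAlgHom (CStarLimit.of (ampl l) i a) (gnsIncl l i b) =
      gnsIncl l i (a * b) := by
  have h : CStarLimit.of (ampl l) i (a * b) =
    CStarLimit.of (ampl l) i a * CStarLimit.of (ampl l) i b := map_mul _ _ _
  simp [gnsIncl, h]

theorem gnsStarAlgHom_of_mem_gnsStage {i k : ℕ} (h : i ≤ k) (a : Mat (dim l i)) {x : GNSSpace l}
    (hx : x ∈ gnsStage l k) :
    (uhfTrace l).gnsStarAlgHom (CStarLimit.of (ampl l) i a) x ∈ gnsStage l k := by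
  obtain ⟨b, rfl⟩ := hx
  rw [← CStarLimit.of_seqMap (ampl l) i k h, gnsStarAlgHom_of_gnsIncl]
  exact ⟨_, rfl⟩

/-- The matrices of stage `i` leave `𝔥_k` invariant for `k ≥ i`. -/
theorem commute_gnsStarAlgHom_of {i k : ℕ} (h : i ≤ k) (a : Mat (dim l i)) :
    Commute ((uhfTrace l).gnsStarAlgHom (CStarLimit.of (ampl l) i a))
      (gnsStage l k).starProjection := by
  refine commute_starProjection (fun x hx => gnsStarAlgHom_of_mem_gnsStage l h a hx)
    fun x hx => ?_
  rw [← map_star, ← map_star]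
  exact gnsStarAlgHom_of_mem_gnsStage l h (star a) hx

/-- The GNS representation of the trace is faithful, since it is isometric on each `M_{n_i}`. -/
theorem gnsStarAlgHom_injective : Function.Injective (uhfTrace l).gnsStarAlgHom := by
  refine CStarLimit.injective_of_norm_le _ fun i a => ?_
  rw [norm_of_ampl]
  refine (NonUnitalStarAlgHom.norm_map
    ((uhfTrace l).gnsStarAlgHom.comp (CStarLimit.of (ampl l) i)) ?_ a).ge
  intro a b hab
  have h := congrArg (fun T : GNSSpace l →L[ℂ] GNSSpace l => T (gnsIncl l i 1)) hab
  simp only [StarAlgHom.comp_apply, gnsStarAlgHom_of_gnsIncl, mul_one] at h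
  exact gnsIncl_injective l i h

end UHF

/-! ### Lipschitz functions on the interval -/

section Lipschitz

theorem LipschitzBound.nonneg {E : Type} [PseudoMetricSpace E] {C : ℝ} {f : C(I, E)}
    (h : LipschitzBound C f) : 0 ≤ C := by
  simpa using dist_nonneg.trans (h 0 1)

variable {A : Type} [CStarAlgebra A]

theorem LipschitzBound.algebraMap (c : ℂ) : LipschitzBound 0 (algebraMap ℂ C(I, A) c) :=
  fun x y => by simp [Algebra.algebraMap_eq_smul_one]

theorem LipschitzBound.add {C C' : ℝ} {f g : C(I, A)} (hf : LipschitzBound C f)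
    (hg : LipschitzBound C' g) : LipschitzBound (C + C') (f + g) := fun x y => by
  rw [add_mul]
  exact (dist_add_add_le _ _ _ _).trans (add_le_add (hf x y) (hg x y))

theorem LipschitzBound.smul {C : ℝ} {f : C(I, A)} (c : ℂ) (hf : LipschitzBound C f) :
    LipschitzBound (‖c‖ * C) (c • f) := fun x y => by
  rw [ContinuousMap.smul_apply, ContinuousMap.smul_apply, dist_smul₀, mul_assoc]
  exact mul_le_mul_of_nonneg_left (hf x y) (norm_nonneg c)

theorem LipschitzBound.star {C : ℝ} {f : C(I, A)} (hf : LipschitzBound C f) :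
    LipschitzBound C (star f) := fun x y => by
  rw [ContinuousMap.star_apply, ContinuousMap.star_apply, dist_eq_norm, ← star_sub, norm_star,
    ← dist_eq_norm]
  exact hf x y

theorem LipschitzBound.mul {C C' : ℝ} {f g : C(I, A)} (hf : LipschitzBound C f)
    (hg : LipschitzBound C' g) : LipschitzBound (C * ‖g‖ + ‖f‖ * C') (f * g) := fun x y => by
  have h1 : f x * g x - f y * g y = (f x - f y) * g x + f y * (g x - g y) := by noncomm_ring
  have h2 := hf x y
  have h3 := hg x y
  rw [dist_eq_norm] at h2 h3
  have h4 := dist_nonneg.trans (hf x y)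
  rw [ContinuousMap.mul_apply, ContinuousMap.mul_apply, dist_eq_norm, h1]
  calc ‖(f x - f y) * g x + f y * (g x - g y)‖
      ≤ ‖f x - f y‖ * ‖g x‖ + ‖f y‖ * ‖g x - g y‖ :=
        (norm_add_le _ _).trans (add_le_add (norm_mul_le _ _) (norm_mul_le _ _))
    _ ≤ (C * |(x : ℝ) - y|) * ‖g‖ + ‖f‖ * (C' * |(x : ℝ) - y|) := by
        gcongr
        exacts [g.norm_coe_le_norm x, f.norm_coe_le_norm y]
    _ = (C * ‖g‖ + ‖f‖ * C') * |(x : ℝ) - y| := by ring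

variable (A) in
/-- Evaluation at a point of the interval. -/
def evalHom (t : I) : C(I, A) →⋆ₐ[ℂ] A where
  toFun f := f t
  map_one' := rfl
  map_mul' _ _ := rfl
  map_zero' := rfl
  map_add' _ _ := rfl
  commutes' _ := rfl
  map_star' _ := rfl

/-- A function on the interval with small oscillation almost attains its norm at every point. -/
theorem norm_le_norm_apply_add {f : C(I, A)} {ε : ℝ} (hε : 0 ≤ ε)
    (hf : ∀ x y, ‖f x - f y‖ ≤ ε) (y : I) : ‖f‖ ≤ ‖f y‖ + ε :=
  (ContinuousMap.norm_le f (by positivity)).mpr fun x => by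
    have := norm_sub_norm_le (f x) (f y)
    linarith [hf x y]

theorem norm_le_one_of_mem_unitary {u : A} (hu : u ∈ unitary A) : ‖u‖ ≤ 1 := by
  rcases subsingleton_or_nontrivial A with h | h
  · simp [Subsingleton.elim u 0]
  · exact (CStarRing.norm_of_mem_unitary hu).le

theorem norm_unitary_conj {u : A} (hu : u ∈ unitary A) (x : A) : ‖star u * x * u‖ = ‖x‖ := by
  rw [CStarRing.norm_mul_mem_unitary _ hu,
    CStarRing.norm_mem_unitary_mul _ (Unitary.star_mem hu)]

end Lipschitz

/-! ### Oscillation along the untwisted system -/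

theorem norm_blockDiag_sub_le {l n : ℕ} {a b : Fin l → Mat n} {c : ℝ} (hc : 0 ≤ c)
    (h : ∀ s, ‖a s - b s‖ ≤ c) : ‖blockDiag l n a - blockDiag l n b‖ ≤ c := by
  rw [← map_sub]
  exact (NonUnitalStarAlgHom.norm_apply_le (blockDiag l n) (a - b)).trans
    ((pi_norm_le_iff_of_nonneg hc).mpr h)

namespace IntervalSystem

variable (S : IntervalSystem)

theorem untwisted_apply (i : ℕ) (f : C(I, Mat (S.n i))) (t : I) :
    S.untwisted i f t = blockDiag (S.l i) (S.n i) fun s => f (S.ξ i s t) := rfl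

theorem comp_mem_pathSet {i k : ℕ} (h : i ≤ k) {ζ : C(I, I)} (hζ : ζ ∈ pathSet S.ξ i (k - i))
    (s : Fin (S.l k)) : ζ.comp (S.ξ k s) ∈ pathSet S.ξ i (k + 1 - i) := by
  obtain ⟨d, rfl⟩ := Nat.exists_eq_add_of_le h
  rw [Nat.add_sub_cancel_left] at hζ
  rw [add_assoc, Nat.add_sub_cancel_left]
  exact ⟨ζ, hζ, s, rfl⟩

/-- The values of `φ̃_{i,k}(g)` at two points differ by no more than the values of `g` at the ends of
the paths. -/
theorem norm_seqMap_untwisted_sub_le {i k : ℕ} (h : i ≤ k) (g : C(I, Mat (S.n i))) {ε : ℝ}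
    (hε : 0 ≤ ε) (x y : I) (hg : ∀ η ∈ pathSet S.ξ i (k - i), ‖g (η x) - g (η y)‖ ≤ ε) :
    ‖seqMap S.untwisted i k h g x - seqMap S.untwisted i k h g y‖ ≤ ε := by
  induction k, h using Nat.le_induction generalizing x y with
  | base =>
    rw [seqMap_self]
    exact hg (ContinuousMap.id I) (by rw [Nat.sub_self]; rfl)
  | succ k h ih =>
    rw [seqMap_succ S.untwisted i k h, StarAlgHom.comp_apply, untwisted_apply, untwisted_apply]
    exact norm_blockDiag_sub_le hε fun s =>
      ih _ _ fun ζ hζ => hg (ζ.comp (S.ξ k s)) (S.comp_mem_pathSet h hζ s)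

/-- If `g` oscillates by at most `ε`, then repeating one value of `g` along the blocks and evaluating
`φ̃_{k,m}(g)` agree up to `ε`. -/
theorem norm_seqMap_ampl_sub_le {k m : ℕ} (h : k ≤ m) (g : C(I, Mat (S.n k))) {ε : ℝ}
    (hε : 0 ≤ ε) (hg : ∀ x y, ‖g x - g y‖ ≤ ε) (x y : I) :
    ‖seqMap (ampl S.l) k m h (g x) - seqMap S.untwisted k m h g y‖ ≤ ε := by
  induction m, h using Nat.le_induction generalizing y with
  | base => rw [seqMap_self, seqMap_self]; exact hg x y
  | succ m h ih =>
    rw [seqMap_succ (ampl S.l) k m h, seqMap_succ S.untwisted k m h, StarAlgHom.comp_apply,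
      StarAlgHom.comp_apply, untwisted_apply]
    exact norm_blockDiag_sub_le hε fun s => ih _

/-- The image in `M` of the matrix `φ̃_{i,k}(g)(0)`. -/
def sample (i k : ℕ) (h : i ≤ k) : C(I, Mat (S.n i)) →⋆ₐ[ℂ] UHF S.l :=
  (CStarLimit.of (ampl S.l) k).comp
    ((evalHom (Mat (S.n k)) 0).comp (seqMap S.untwisted i k h))

theorem sample_apply (i k : ℕ) (h : i ≤ k) (g : C(I, Mat (S.n i))) :
    S.sample i k h g = CStarLimit.of (ampl S.l) k (seqMap S.untwisted i k h g 0) := rfl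

/-- Once `φ̃_{i,k}(g)` oscillates by at most `ε`, the samples move by at most `ε` after stage `k`. -/
theorem norm_sample_sub_sample_le {i k m : ℕ} (h : i ≤ k) (hkm : k ≤ m) (g : C(I, Mat (S.n i)))
    {ε : ℝ} (hε : 0 ≤ ε) (hg : ∀ x y,
      ‖seqMap S.untwisted i k h g x - seqMap S.untwisted i k h g y‖ ≤ ε) :
    ‖S.sample i k h g - S.sample i m (h.trans hkm) g‖ ≤ ε := by
  rw [sample_apply, sample_apply, ← seqMap_seqMap S.untwisted i k m h hkm,
    ← CStarLimit.of_seqMap (ampl S.l) k m hkm, ← map_sub, norm_of_ampl]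
  exact S.norm_seqMap_ampl_sub_le hkm _ hε hg 0 0

/-- Since the paths contract, the oscillation of `φ̃_{i,k}(g)` tends to zero. -/
theorem exists_oscillation_le (i : ℕ) (g : C(I, Mat (S.n i))) {ε : ℝ} (hε : 0 < ε) :
    ∃ K, ∀ k (h : i ≤ k), K ≤ k → ∀ x y,
      ‖seqMap S.untwisted i k h g x - seqMap S.untwisted i k h g y‖ ≤ ε := by
  obtain ⟨δ, hδ, hg⟩ := Metric.uniformContinuous_iff.mp
    (CompactSpace.uniformContinuous_of_continuous g.continuous) ε hε
  obtain ⟨D, hD⟩ := exists_pow_lt_of_lt_one hδ (by norm_num : (1 / 2 : ℝ) < 1)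
  refine ⟨i + D, fun k h hk x y => S.norm_seqMap_untwisted_sub_le h g hε.le x y fun η hη => ?_⟩
  rw [← dist_eq_norm]
  refine (hg ?_).le
  calc dist (η x) (η y) = |(η x : ℝ) - η y| := rfl
    _ ≤ (1 / 2) ^ (k - i) := S.oscillation i _ η hη x y
    _ ≤ (1 / 2) ^ D := pow_le_pow_of_le_one (by norm_num) (by norm_num) (by omega)
    _ < δ := hD

theorem cauchySeq_sample (i : ℕ) (g : C(I, Mat (S.n i))) :
    CauchySeq fun d : ℕ => S.sample i (i + d) (Nat.le_add_right i d) g := by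
  rw [Metric.cauchySeq_iff']
  intro ε hε
  obtain ⟨K, hK⟩ := S.exists_oscillation_le i g (half_pos hε)
  refine ⟨K, fun d hd => ?_⟩
  rw [dist_comm, dist_eq_norm]
  exact (S.norm_sample_sub_sample_le (Nat.le_add_right i K) (by omega) g (half_pos hε).le
    (hK _ _ (by omega))).trans_lt (half_lt_self hε)

/-- The limit in `M` of the samples of `g`. -/
def sampleLimitFun (i : ℕ) (g : C(I, Mat (S.n i))) : UHF S.l :=
  limUnder atTop fun d : ℕ => S.sample i (i + d) (Nat.le_add_right i d) g

theorem tendsto_sample (i : ℕ) (g : C(I, Mat (S.n i))) :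
    Tendsto (fun d : ℕ => S.sample i (i + d) (Nat.le_add_right i d) g) atTop
      (𝓝 (S.sampleLimitFun i g)) :=
  (S.cauchySeq_sample i g).tendsto_limUnder

/-- `sampleLimitFun` as a morphism. -/
def sampleLimit (i : ℕ) : C(I, Mat (S.n i)) →⋆ₐ[ℂ] UHF S.l where
  toFun := S.sampleLimitFun i
  map_one' := tendsto_nhds_unique (S.tendsto_sample i 1) (by simp)
  map_mul' f g := tendsto_nhds_unique (S.tendsto_sample i (f * g)) <| by
    simpa only [map_mul] using (S.tendsto_sample i f).mul (S.tendsto_sample i g)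
  map_zero' := tendsto_nhds_unique (S.tendsto_sample i 0) (by simp)
  map_add' f g := tendsto_nhds_unique (S.tendsto_sample i (f + g)) <| by
    simpa only [map_add] using (S.tendsto_sample i f).add (S.tendsto_sample i g)
  commutes' c := tendsto_nhds_unique (S.tendsto_sample i _) <| by
    simp only [AlgHomClass.commutes]
    exact tendsto_const_nhds
  map_star' f := tendsto_nhds_unique (S.tendsto_sample i (star f)) <| by
    simpa only [map_star] using (S.tendsto_sample i f).star

theorem norm_sampleLimit_sub_sample_le {i k : ℕ} (h : i ≤ k) (g : C(I, Mat (S.n i)))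
    {ε : ℝ} (hε : 0 ≤ ε) (hg : ∀ x y,
      ‖seqMap S.untwisted i k h g x - seqMap S.untwisted i k h g y‖ ≤ ε) :
    ‖S.sampleLimit i g - S.sample i k h g‖ ≤ ε := by
  refine le_of_tendsto ((S.tendsto_sample i g).sub_const (S.sample i k h g)).norm ?_
  filter_upwards [eventually_ge_atTop k] with d hd
  rw [norm_sub_rev]
  exact S.norm_sample_sub_sample_le h (by omega) g hε hg

theorem norm_le_norm_sampleLimit (i : ℕ) (g : C(I, Mat (S.n i))) {c : ℝ}
    (hc : ∀ k (h : i ≤ k), c ≤ ‖seqMap S.untwisted i k h g‖) : c ≤ ‖S.sampleLimit i g‖ := by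
  refine le_of_forall_pos_le_add fun ε hε => ?_
  obtain ⟨K, hK⟩ := S.exists_oscillation_le i g (half_pos hε)
  have h := hK (max i K) (le_max_left _ _) (le_max_right _ _)
  have h1 := norm_le_norm_apply_add (half_pos hε).le h 0
  have h2 := S.norm_sampleLimit_sub_sample_le (le_max_left _ _) g (half_pos hε).le h
  have h3 : ‖S.sample i (max i K) (le_max_left _ _) g‖ =
      ‖seqMap S.untwisted i _ (le_max_left _ _) g 0‖ := norm_of_ampl S.l _ _
  have h4 := norm_sub_norm_le (S.sample i (max i K) (le_max_left _ _) g) (S.sampleLimit i g)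
  rw [norm_sub_rev] at h4
  linarith [hc _ (le_max_left i K)]

theorem sampleLimit_untwisted (i : ℕ) (g : C(I, Mat (S.n i))) :
    S.sampleLimit (i + 1) (S.untwisted i g) = S.sampleLimit i g := by
  refine eq_of_forall_dist_le fun ε hε => ?_
  obtain ⟨K, hK⟩ := S.exists_oscillation_le i g (half_pos hε)
  have h := hK (max (i + 1) K) (by omega) (le_max_right _ _)
  have hk : i + 1 ≤ max (i + 1) K := le_max_left _ _
  have h0 : seqMap S.untwisted (i + 1) (max (i + 1) K) hk (S.untwisted i g) =
      seqMap S.untwisted i (max (i + 1) K) (i.le_succ.trans hk) g := by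
    rw [← seqMap_seqMap S.untwisted i (i + 1) _ i.le_succ hk,
      show seqMap S.untwisted i (i + 1) i.le_succ = _ from seqMap_succ S.untwisted i i le_rfl,
      seqMap_self]
    rfl
  have h1 := S.norm_sampleLimit_sub_sample_le _ g (half_pos hε).le h
  have h2 := S.norm_sampleLimit_sub_sample_le hk (S.untwisted i g) (half_pos hε).le (by rwa [h0])
  rw [sample_apply, h0, ← sample_apply] at h2
  have h3 := dist_triangle_right (S.sampleLimit (i + 1) (S.untwisted i g)) (S.sampleLimit i g)
    (S.sample i _ (i.le_succ.trans hk) g)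
  rw [dist_eq_norm _ (S.sample i _ _ g), dist_eq_norm _ (S.sample i _ _ g)] at h3
  linarith

/-! ### The embedding into the UHF algebra -/

theorem totalUnitary_mem (i : ℕ) : S.totalUnitary i ∈ unitary C(I, Mat (S.n i)) := by
  induction i with
  | zero => exact one_mem _
  | succ i ih => exact mul_mem (S.u i).2 (Unitary.map_mem (S.untwisted i) ih)

/-- `f ↦ f̃` as a morphism. -/
def untwistHom (i : ℕ) : C(I, Mat (S.n i)) →⋆ₐ[ℂ] C(I, Mat (S.n i)) :=
  (Unitary.conjStarAlgAut ℂ C(I, Mat (S.n i)) (star ⟨S.totalUnitary i, S.totalUnitary_mem i⟩) :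
    C(I, Mat (S.n i)) →⋆ₐ[ℂ] C(I, Mat (S.n i)))

theorem untwistHom_apply (i : ℕ) (f : C(I, Mat (S.n i))) :
    S.untwistHom i f = S.untwist i f :=
  Unitary.conjStarAlgAut_star_apply (S := ℂ) (R := C(I, Mat (S.n i)))
    ⟨S.totalUnitary i, S.totalUnitary_mem i⟩ f

theorem norm_untwist (i : ℕ) (f : C(I, Mat (S.n i))) : ‖S.untwist i f‖ = ‖f‖ :=
  norm_unitary_conj (S.totalUnitary_mem i) f

theorem totalUnitary_mul_untwist_mul (i : ℕ) (f : C(I, Mat (S.n i))) :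
    S.totalUnitary i * S.untwist i f * star (S.totalUnitary i) = f := by
  have h := (Unitary.mem_iff.mp (S.totalUnitary_mem i)).2
  rw [untwist, mul_assoc, mul_assoc, mul_assoc, h, mul_one, ← mul_assoc, h, one_mul]

/-- `f ↦ f̃` intertwines the connecting morphisms `φ_i` and `φ̃_i`. -/
theorem untwist_conn (i : ℕ) (f : S.Stage i) :
    S.untwist (i + 1) (S.toFunction (i + 1) (S.conn i f)) =
      S.untwisted i (S.untwist i (S.toFunction i f)) := by
  have h := (Unitary.mem_iff.mp (S.u i).2).1
  rw [untwist, untwist, toFunction_conn, totalUnitary, map_mul, map_mul, map_star, star_mul]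
  calc _ = star (S.untwisted i (S.totalUnitary i)) *
        (star (S.u i : C(I, Mat (S.n (i + 1)))) * S.u i) *
        S.untwisted i (S.toFunction i f) * (star (S.u i : C(I, Mat (S.n (i + 1)))) * S.u i) *
        S.untwisted i (S.totalUnitary i) := by simp only [mul_assoc]
    _ = _ := by rw [h, mul_one, mul_one]

theorem untwist_seqMap_conn {i k : ℕ} (h : i ≤ k) (f : S.Stage i) :
    S.untwist k (S.toFunction k (seqMap S.conn i k h f)) =
      seqMap S.untwisted i k h (S.untwist i (S.toFunction i f)) := by
  induction k, h using Nat.le_induction with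
  | base => rw [seqMap_self, seqMap_self]; rfl
  | succ k h ih =>
    rw [seqMap_succ S.conn i k h, seqMap_succ S.untwisted i k h, StarAlgHom.comp_apply,
      untwist_conn, ih]
    rfl

theorem norm_toFunction (i : ℕ) (f : S.Stage i) : ‖S.toFunction i f‖ = ‖f‖ := rfl

theorem norm_seqMap_conn {i k : ℕ} (h : i ≤ k) (f : S.Stage i) :
    ‖seqMap S.conn i k h f‖ = ‖seqMap S.untwisted i k h (S.untwist i (S.toFunction i f))‖ := by
  rw [← untwist_seqMap_conn, norm_untwist, norm_toFunction]

/-- The embedding of `B` into the UHF algebra. -/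
def afEmbedding : S.limit →⋆ₐ[ℂ] UHF S.l :=
  CStarLimit.lift (fun i => (S.sampleLimit i).comp ((S.untwistHom i).comp (S.toFunction i)))
    fun i f => by
      simp only [StarAlgHom.comp_apply, untwistHom_apply, untwist_conn, sampleLimit_untwisted]

theorem afEmbedding_incl (i : ℕ) (f : S.Stage i) :
    S.afEmbedding (S.incl i f) = S.sampleLimit i (S.untwist i (S.toFunction i f)) := by
  rw [afEmbedding, incl, CStarLimit.lift_of, StarAlgHom.comp_apply, StarAlgHom.comp_apply,
    untwistHom_apply]

theorem afEmbedding_isAFEmbedding : S.IsAFEmbedding S.afEmbedding := by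
  refine ⟨CStarLimit.injective_of_norm_le _ fun i f => ?_, fun i f => ?_⟩
  · change _ ≤ ‖S.afEmbedding (S.incl i f)‖
    rw [afEmbedding_incl]
    refine S.norm_le_norm_sampleLimit i _ fun k h => ?_
    rw [← norm_seqMap_conn, ← CStarLimit.of_seqMap S.conn i k h]
    exact CStarLimit.norm_of_le S.conn k _
  · rw [afEmbedding_incl]
    exact S.tendsto_sample i _

end IntervalSystem

namespace IntervalSystem

variable (S : IntervalSystem)

/-! ### Approximation of Lipschitz elements by matrices -/

theorem exists_lipschitzBound_untwist (hu : ∀ i, ∃ C, LipschitzBound C (S.totalUnitary i)) (i : ℕ)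
    {f : C(I, Mat (S.n i))} (hf : ∃ C, LipschitzBound C f) :
    ∃ C, LipschitzBound C (S.untwist i f) := by
  obtain ⟨C, hC⟩ := hu i
  obtain ⟨C', hC'⟩ := hf
  exact ⟨_, (hC.star.mul hC').mul hC⟩

/-- The image of a Lipschitz element in `M` is approximated by the samples at the stages `r n` at
rate `4⁻ⁿ`. -/
theorem hasRapidApprox_incl (hu : ∀ i, ∃ C, LipschitzBound C (S.totalUnitary i))
    (r : ℕ → ℕ) (hr : StrictMono r)
    (hosc : ∀ i j d, i ≤ r j → ∀ η ∈ pathSet S.ξ i (r (j + d) - i), ∀ x y : I,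
      |(η x : ℝ) - η y| ≤ (1 / 2) ^ (2 * d))
    (i : ℕ) (f : S.Stage i) (hf : ∃ C, LipschitzBound C (S.toFunction i f)) :
    HasRapidApprox (fun n => gnsStage S.l (r n))
      ((uhfTrace S.l).gnsStarAlgHom (S.afEmbedding (S.incl i f))) := by
  obtain ⟨C, hC⟩ := S.exists_lipschitzBound_untwist hu i hf
  have hC0 := hC.nonneg
  set g := S.untwist i (S.toFunction i f) with hg
  have hri : ∀ n, i ≤ n → i ≤ r n := fun n hn => hn.trans hr.le_apply
  refine HasRapidApprox.of_eventually (K := C * 4 ^ i)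
    (fun n => if h : i ≤ r n then (uhfTrace S.l).gnsStarAlgHom (S.sample i (r n) h g) else 0) i
    (fun n m hnm => ?_) fun n hn => ?_
  · split_ifs with h
    · exact commute_gnsStarAlgHom_of S.l (hr.monotone hnm) _
    · exact Commute.zero_left _
  · rw [dif_pos (hri n hn), ← map_sub, afEmbedding_incl, ← hg]
    refine (NonUnitalStarAlgHom.norm_apply_le _ _).trans ?_
    refine S.norm_sampleLimit_sub_sample_le (hri n hn) g (by positivity) fun x y =>
      S.norm_seqMap_untwisted_sub_le (hri n hn) g (by positivity) x y fun η hη => ?_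
    obtain ⟨d, rfl⟩ := Nat.exists_eq_add_of_le hn
    have h1 := hosc i i d (hri i le_rfl) η hη x y
    rw [← dist_eq_norm]
    calc dist (g (η x)) (g (η y)) ≤ C * |(η x : ℝ) - η y| := hC _ _
      _ ≤ C * (1 / 2) ^ (2 * d) := by gcongr
      _ = C * 4 ^ i / 4 ^ (i + d) := by
        rw [pow_mul, pow_add, show ((1 : ℝ) / 2) ^ 2 = 4⁻¹ by norm_num, inv_pow]
        field_simp

/-! ### Density -/

theorem incl_mem_adjoin {γ : ℝ} (hγ : 1 < γ) (i : ℕ) (f : S.Stage i)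
    (hf : ∃ C, LipschitzBound C (S.toFunction i f)) :
    S.incl i f ∈ StarAlgebra.adjoin ℂ (S.LBUnion γ) := by
  obtain ⟨C, hC⟩ := hf
  have hC0 := hC.nonneg
  -- A small multiple of `f` satisfies the bound defining `LB_i`.
  have hc : (0 : ℝ) < (C + 1)⁻¹ := by positivity
  have hc' : (((C + 1)⁻¹ : ℝ) : ℂ) ≠ 0 := by exact_mod_cast hc.ne'
  have h1 : S.incl i ((((C + 1)⁻¹ : ℝ) : ℂ) • f) ∈ StarAlgebra.adjoin ℂ (S.LBUnion γ) := by
    refine StarAlgebra.subset_adjoin ℂ _ (Set.mem_iUnion.mpr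
      ⟨i, _, ⟨‖(((C + 1)⁻¹ : ℝ) : ℂ)‖ * C, ?_, ?_⟩, rfl⟩)
    · rw [Complex.norm_real, Real.norm_of_nonneg hc.le]
      refine lt_of_lt_of_le ?_ (one_le_pow₀ hγ.le)
      rw [inv_mul_lt_iff₀ (by positivity)]
      linarith
    · rw [map_smul]
      exact hC.smul _
  have h2 := StarSubalgebra.smul_mem _ h1 (((C + 1)⁻¹ : ℝ) : ℂ)⁻¹
  rwa [map_smul, smul_smul, inv_mul_cancel₀ hc', one_smul] at h2

theorem dense_adjoin_LBUnion {γ : ℝ} (hγ : 1 < γ) :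
    Dense (StarAlgebra.adjoin ℂ (S.LBUnion γ) : Set S.limit) := by
  rw [← dense_closure]
  refine (CStarLimit.dense_iUnion_range S.conn).mono (Set.iUnion_subset fun i => ?_)
  rintro _ ⟨f, rfl⟩
  rw [Metric.mem_closure_iff]
  intro ε hε
  obtain ⟨g, ⟨hgB, hg⟩, hfg⟩ := Metric.mem_closure_iff.mp (S.dense_lipschitz i f.2) ε hε
  obtain ⟨g, rfl⟩ : ∃ g' : S.Stage i, S.toFunction i g' = g := ⟨⟨g, hgB⟩, rfl⟩
  refine ⟨S.incl i g, S.incl_mem_adjoin hγ i g hg, lt_of_le_of_lt ?_ hfg⟩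
  change dist (S.incl i f) (S.incl i g) ≤ dist f g
  rw [dist_eq_norm, dist_eq_norm, ← map_sub]
  exact CStarLimit.norm_of_le S.conn i _

/-! ### Uniformly Lipschitz systems -/

/-- The images of a Lipschitz element in the later stages have a common Lipschitz constant. -/
theorem exists_lipschitzBound_seqMap_conn {C : ℝ} (hC : ∀ i, LipschitzBound C (S.totalUnitary i) ∧
      ∀ d, ∀ η ∈ pathSet S.ξ i d, LipschitzBound C η)
    (i : ℕ) (f : S.Stage i)
    (hf : ∃ L, LipschitzBound L (S.toFunction i f)) :
    ∃ L, ∀ k (h : i ≤ k), LipschitzBound L (S.toFunction k (seqMap S.conn i k h f)) := by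
  obtain ⟨L, hL⟩ := S.exists_lipschitzBound_untwist (fun i => ⟨C, (hC i).1⟩) i hf
  set g := S.untwist i (S.toFunction i f) with hg
  have hL0 := hL.nonneg
  have hC0 := (hC 0).1.nonneg
  refine ⟨(C * ‖g‖ + 1 * (L * C)) * 1 + ‖g‖ * C, fun k h => ?_⟩
  set G := seqMap S.untwisted i k h g with hG
  have h1 : LipschitzBound (L * C) G := fun x y => by
    rw [dist_eq_norm]
    refine S.norm_seqMap_untwisted_sub_le h g (by positivity) x y fun η hη => ?_
    rw [← dist_eq_norm, mul_assoc]
    refine (hL (η x) (η y)).trans ?_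
    gcongr
    exact (hC i).2 _ η hη x y
  have h2 : S.toFunction k (seqMap S.conn i k h f) =
      S.totalUnitary k * G * star (S.totalUnitary k) := by
    rw [hG, hg, ← untwist_seqMap_conn, totalUnitary_mul_untwist_mul]
  have hGn : ‖G‖ ≤ ‖g‖ := seqMap_norm_le S.untwisted i k h g
  have hU := norm_le_one_of_mem_unitary (S.totalUnitary_mem k)
  rw [h2]
  intro x y
  refine ((((hC k).1.mul h1).mul (hC k).1.star) x y).trans ?_
  have h3 : ‖S.totalUnitary k * G‖ ≤ ‖g‖ :=
    (norm_mul_le _ _).trans ((mul_le_mul hU hGn (norm_nonneg _) zero_le_one).trans_eq (one_mul _))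
  have hU' := norm_le_one_of_mem_unitary (Unitary.star_mem (S.totalUnitary_mem k))
  gcongr

/-- In a uniformly Lipschitz system every Lipschitz element lies in `⋃ LB_i`, since `γ ^ k → ∞`. -/
theorem incl_mem_LBUnion {C : ℝ} (hC : ∀ i, LipschitzBound C (S.totalUnitary i) ∧
      ∀ d, ∀ η ∈ pathSet S.ξ i d, LipschitzBound C η)
    {γ : ℝ} (hγ : 1 < γ) (i : ℕ) (f : S.Stage i)
    (hf : ∃ L, LipschitzBound L (S.toFunction i f)) : S.incl i f ∈ S.LBUnion γ := by
  obtain ⟨L, hL⟩ := S.exists_lipschitzBound_seqMap_conn hC i f hf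
  obtain ⟨N, hN⟩ := pow_unbounded_of_one_lt L hγ
  have hk : i ≤ max i N := le_max_left i N
  rw [incl, ← CStarLimit.of_seqMap S.conn i _ hk]
  refine Set.mem_iUnion.mpr ⟨max i N, _, ⟨L, ?_, hL _ hk⟩, rfl⟩
  exact hN.trans_le (pow_le_pow_right₀ hγ.le (le_max_right i N))

/-- Two elements of `⋃ LB_i` are represented by Lipschitz functions of a common stage. -/
theorem exists_common_stage {C : ℝ} (hC : ∀ i, LipschitzBound C (S.totalUnitary i) ∧
      ∀ d, ∀ η ∈ pathSet S.ξ i d, LipschitzBound C η)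
    {γ : ℝ} {a b : S.limit} (ha : a ∈ S.LBUnion γ)
    (hb : b ∈ S.LBUnion γ) : ∃ k, ∃ f g : S.Stage k, S.incl k f = a ∧ S.incl k g = b ∧
      (∃ L, LipschitzBound L (S.toFunction k f)) ∧ ∃ L, LipschitzBound L (S.toFunction k g) := by
  obtain ⟨i, f, ⟨L, -, hL⟩, rfl⟩ := Set.mem_iUnion.mp ha
  obtain ⟨j, g, ⟨L', -, hL'⟩, rfl⟩ := Set.mem_iUnion.mp hb
  obtain ⟨M, hM⟩ := S.exists_lipschitzBound_seqMap_conn hC i f ⟨L, hL⟩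
  obtain ⟨M', hM'⟩ := S.exists_lipschitzBound_seqMap_conn hC j g ⟨L', hL'⟩
  exact ⟨max i j, _, _, CStarLimit.of_seqMap S.conn i _ (le_max_left i j) f,
    CStarLimit.of_seqMap S.conn j _ (le_max_right i j) g, ⟨M, hM _ _⟩, ⟨M', hM' _ _⟩⟩

theorem adjoin_LBUnion_eq {C : ℝ} (hC : ∀ i, LipschitzBound C (S.totalUnitary i) ∧
      ∀ d, ∀ η ∈ pathSet S.ξ i d, LipschitzBound C η)
    {γ : ℝ} (hγ : 1 < γ) :
    (StarAlgebra.adjoin ℂ (S.LBUnion γ) : Set S.limit) = S.LBUnion γ := by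
  refine Set.Subset.antisymm (fun a ha => ?_) (StarAlgebra.subset_adjoin ℂ _)
  induction ha using StarAlgebra.adjoin_induction with
  | mem a ha => exact ha
  | algebraMap c =>
    rw [← AlgHomClass.commutes (S.incl 0) c]
    refine S.incl_mem_LBUnion hC hγ 0 _ ⟨0, ?_⟩
    rw [AlgHomClass.commutes]
    exact LipschitzBound.algebraMap c
  | add a b _ _ ha hb =>
    obtain ⟨k, f, g, rfl, rfl, ⟨L, hf⟩, L', hg⟩ := S.exists_common_stage hC ha hb
    rw [← map_add]
    refine S.incl_mem_LBUnion hC hγ k _ ⟨L + L', ?_⟩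
    rw [map_add]
    exact hf.add hg
  | mul a b _ _ ha hb =>
    obtain ⟨k, f, g, rfl, rfl, ⟨L, hf⟩, L', hg⟩ := S.exists_common_stage hC ha hb
    rw [← map_mul]
    refine S.incl_mem_LBUnion hC hγ k _ ⟨L * ‖S.toFunction k g‖ + ‖S.toFunction k f‖ * L', ?_⟩
    rw [map_mul]
    exact hf.mul hg
  | star a _ ha =>
    obtain ⟨i, f, ⟨L, hL, hf⟩, rfl⟩ := Set.mem_iUnion.mp ha
    rw [← map_star]
    refine Set.mem_iUnion.mpr ⟨i, _, ⟨L, hL, ?_⟩, rfl⟩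
    rw [map_star]
    exact hf.star

end IntervalSystem

/-! ### The spectral triple -/

theorem top_le_topologicalClosure_iSup_gnsStage (l : ℕ → ℕ+) {r : ℕ → ℕ} (hr : StrictMono r) :
    ⊤ ≤ (⨆ n, gnsStage l (r n)).topologicalClosure := by
  rw [← dense_iSup_gnsStage l]
  exact Submodule.topologicalClosure_mono
    (iSup_le fun i => (gnsStage_mono l hr.le_apply).trans (le_iSup (fun n => gnsStage l (r n)) i))

end

theorem mainTheorem1 (S : IntervalSystem)
    (hu : ∀ i, ∃ C, LipschitzBound C (S.totalUnitary i))
    (r : ℕ → ℕ) (hr : StrictMono r) (hr0 : r 0 = 0)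
    (hosc : ∀ i j d, i ≤ r j → ∀ η ∈ pathSet S.ξ i (r (j + d) - i), ∀ x y : I,
      |(η x : ℝ) - η y| ≤ (1 / 2) ^ (2 * d))
    (γ : ℝ) (hγ₁ : 1 < γ) (hγ₂ : γ < 2)
    (α : ℕ → ℝ) (hα₀ : α 0 = 0) (hα : Tendsto (fun n => |α n|) atTop atTop)
    (β : ℝ) (hβ₀ : 0 < β) (hβ₂ : β < 2) (hαβ : ∀ n, 0 < n → |α n| ≤ β ^ (2 * (n - 1))) :
    ∃ ι : S.limit →⋆ₐ[ℂ] UHF S.l, S.IsAFEmbedding ι ∧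
      IsSpectralTriple (StarAlgebra.adjoin ℂ (S.LBUnion γ))
        ((uhfTrace S.l).gnsStarAlgHom.comp ι)
        (diracOp (fun n => gnsStage S.l (r n)) ((gnsStage_mono S.l).comp hr.monotone) α) ∧
      ((∃ C, ∀ i, LipschitzBound C (S.totalUnitary i) ∧
          ∀ d, ∀ η ∈ pathSet S.ξ i d, LipschitzBound C η) →
        (StarAlgebra.adjoin ℂ (S.LBUnion γ) : Set S.limit) = S.LBUnion γ) ∧
      ∀ p : ℝ, 0 < p →
        Summable (fun n => (1 + α (n + 1) ^ 2) ^ (-p / 2) *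
          ((S.n (r (n + 1)) : ℝ) ^ 2 - (S.n (r n) : ℝ) ^ 2)) →
        IsPSummable
          (diracOp (fun n => gnsStage S.l (r n)) ((gnsStage_mono S.l).comp hr.monotone) α) p := by
  have hF : Monotone fun n => gnsStage S.l (r n) := (gnsStage_mono S.l).comp hr.monotone
  have hd := top_le_topologicalClosure_iSup_gnsStage S.l hr
  have hrapid : ∀ a ∈ StarAlgebra.adjoin ℂ (S.LBUnion γ),
      HasRapidApprox (fun n => gnsStage S.l (r n))
        ((uhfTrace S.l).gnsStarAlgHom (S.afEmbedding a)) := fun a ha => by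
    induction ha using StarAlgebra.adjoin_induction with
    | mem a ha =>
      obtain ⟨i, f, ⟨C, -, hC⟩, rfl⟩ := Set.mem_iUnion.mp ha
      exact S.hasRapidApprox_incl hu r hr hosc i f ⟨C, hC⟩
    | algebraMap c =>
      rw [AlgHomClass.commutes, AlgHomClass.commutes]
      exact HasRapidApprox.of_algebraMap c
    | add a b _ _ ha hb => rw [map_add, map_add]; exact ha.add hb
    | mul a b _ _ ha hb => rw [map_mul, map_mul]; exact ha.mul hb
    | star a _ ha => rw [map_star, map_star]; exact ha.star
  -- The bound `|α (n + 1)| ≤ bⁿ` with `1 ≤ b < 4`.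
  have hb₄ : max 1 (β ^ 2) < 4 := max_lt (by norm_num) (by nlinarith)
  have hαb : ∀ n, |α (n + 1)| ≤ max 1 (β ^ 2) ^ n := fun n =>
    calc |α (n + 1)| ≤ β ^ (2 * n) := hαβ (n + 1) n.succ_pos
      _ = (β ^ 2) ^ n := pow_mul β 2 n
      _ ≤ max 1 (β ^ 2) ^ n := by gcongr; exact le_max_right _ _
  refine ⟨S.afEmbedding, S.afEmbedding_isAFEmbedding, ⟨S.dense_adjoin_LBUnion hγ₁, ?_,
    diracOp_isSelfAdjoint hF hd α, diracOp_hasCompactResolvent hF hd hα, fun a ha x hx => ?_,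
    fun a ha => ?_⟩, fun ⟨C, hC⟩ => S.adjoin_LBUnion_eq hC hγ₁, fun p _ hp => ?_⟩
  · exact (gnsStarAlgHom_injective S.l).comp S.afEmbedding_isAFEmbedding.1
  · obtain ⟨T, hT⟩ := (hrapid a ha).bounded_commutator hF hd (le_max_left _ _) hb₄ hα₀ hαb
    exact (hT ⟨x, hx⟩).1
  · obtain ⟨T, hT⟩ := (hrapid a ha).bounded_commutator hF hd (le_max_left _ _) hb₄ hα₀ hαb
    refine ⟨T, fun x h => ?_⟩
    obtain ⟨_, h2⟩ := hT x
    rw [sub_eq_iff_eq_add']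
    exact h2
  · refine diracOp_isPSummable hF hd α p (hp.congr fun n => ?_)
    have h := finrank_layer_succ hF n
    rw [finrank_gnsStage, finrank_gnsStage] at h
    have h' : (Module.finrank ℂ (layer (fun n => gnsStage S.l (r n)) (n + 1)) : ℝ) +
        (S.n (r n) : ℝ) ^ 2 = (S.n (r (n + 1)) : ℝ) ^ 2 := by exact_mod_cast h
    rw [← h', add_sub_cancel_right]
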